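/- Let $k\ge 2$, let $A=\mathbb{Q}[x_1,\dots,x_k]$ be graded by assigning to each $x_i$ a positive even degree $|x_i|$, and let $u_1,\dots,u_k\in A$ be a regular sequence of homogeneous polynomials, of degrees $|u_1|,\dots,|u_k|$. Let $H^*=A/(u_1,\dots,u_k)$ with the induced grading. Quotients of this form, for any number $k\ge 0$ of generators, are called positively elliptic algebras. Suppose that the presentation is a pure model, that is, $|x_1|\le\dots\le|x_k|$, $|u_1|\le\dots\le|u_k|$, and every monomial $x_1^{a_1}\cdots x_k^{a_k}$ occurring in some $u_i$ satisfies $a_1+\dots+a_k\ge 2$. Suppose further that: - $H^*$ does not split: there are no positively elliptic algebras $K^*\ne\mathbb{Q}$ and $Q^*\neq\mathbb{Q}$ with an exact sequence $0\to K^*\to H^*\to Q^*\to 0$, where exactness means that $K^*\to H^*$ is an injective homomorphism of graded $\mathbb{Q}$-algebras which makes $H^*$ a flat $K^*$-module, and that $H^*\to Q^*$ is a surjective homomorphism of graded $\mathbb{Q}$-algebras whose kernel is the ideal of $H^*$ generated by the image of the elements of positive degree in $K^*$; - $H^*$ admits a non-zero derivation of negative degree, that is, a non-zero $\mathbb{Q}$-linear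 derivation $\delta:H^*\to H^*$ and an integer $e<0$ with $\delta(H^n)\subseteq H^{n+e}$ for all $n$ (where $H^m=0$ for $m<0$); - $|x_{k-1}|+|x_k|\le 8$. Then either the formal dimension $\operatorname{fd}H^*=\max\{n: H^n\ne 0\}$ is greater than $20$, or the degree type $(|x_1|,\dots,|x_k|;|u_1|,\dots,|u_k|)$ is one of $$(2,2,4,4;4,6,8,12),\qquad (2,2,4,4;4,8,8,12),\qquad (2,2,2,4,4;4,4,6,8,12).$$ -/

import Mathlib

open MvPolynomial

/-- A presentation `ℚ[x₁, …, x_k] / (u₁, …, u_k)` of a (non-zero) positively elliptic algebra: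
the generators have positive even degrees `|x_i| = deg i`, and the relations `u_i = rel i` are
homogeneous of degree `|u_i| = relDeg i` and form a regular sequence. Indices start at `0`. -/
structure PositivelyElliptic where
  /-- the number of generators, which is also the number of relations -/
  k : ℕ
  deg : Fin k → ℕ
  deg_pos : ∀ i, 0 < deg i
  deg_even : ∀ i, Even (deg i)
  rel : Fin k → MvPolynomial (Fin k) ℚ
  relDeg : Fin k → ℕ
  rel_homogeneous : ∀ i, IsWeightedHomogeneous deg (rel i) (relDeg i)
  rel_regular : RingTheory.Sequence.IsRegular (MvPolynomial (Fin k) ℚ) (List.ofFn rel)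

namespace PositivelyElliptic

/-- The algebra `H = ℚ[x₁, …, x_k] / (u₁, …, u_k)`. -/
abbrev Alg (P : PositivelyElliptic) : Type :=
  MvPolynomial (Fin P.k) ℚ ⧸ Ideal.span (Set.range P.rel)

/-- The graded piece `H^n`, `n ≥ 0`: the image of the polynomials that are homogeneous of
degree `n` for the grading in which `x_i` has degree `|x_i|`. -/
noncomputable def piece (P : PositivelyElliptic) (n : ℕ) : Submodule ℚ P.Alg :=
  (weightedHomogeneousSubmodule ℚ P.deg n).map
    (Ideal.Quotient.mkₐ ℚ (Ideal.span (Set.range P.rel))).toLinearMap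

/-- The graded piece `H^n` for an integer `n`; it is zero for negative `n`. -/
noncomputable def pieceInt (P : PositivelyElliptic) : ℤ → Submodule ℚ P.Alg
  | Int.ofNat n => P.piece n
  | Int.negSucc _ => ⊥

/-- The ideal `H⁺` generated by the elements of positive degree. -/
noncomputable def augmentationIdeal (P : PositivelyElliptic) : Ideal P.Alg :=
  Ideal.span {x | ∃ n : ℕ, 0 < n ∧ x ∈ P.piece n}

/-- The formal dimension (socle degree): the largest `n` with `H^n ≠ 0`. -/
noncomputable def formalDimension (P : PositivelyElliptic) : ℕ :=
  sSup {n : ℕ | P.piece n ≠ ⊥}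

/-- Poincaré duality in dimension `n`: `H^i = 0` for `i > n`, `H^n ≅ ℚ`, and the product pairings
`H^i × H^{n-i} → H^n` are non-degenerate. -/
def PoincareDuality (P : PositivelyElliptic) (n : ℕ) : Prop :=
  (∀ i, n < i → P.piece i = ⊥) ∧ Module.finrank ℚ (P.piece n) = 1 ∧
    ∀ i j, i + j = n → ∀ x ∈ P.piece i, (∀ y ∈ P.piece j, x * y = 0) → x = 0

/-- The formal dimension is the dimension in which Poincaré duality holds. -/
theorem PoincareDuality.formalDimension_eq {P : PositivelyElliptic} {n : ℕ}
    (h : P.PoincareDuality n) : P.formalDimension = n := by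
  refine IsGreatest.csSup_eq ⟨fun h0 => ?_, fun i hi => ?_⟩
  · have h1 := h.2.1
    rw [h0, finrank_bot] at h1
    exact zero_ne_one h1
  · by_contra hlt
    exact hi (h.1 i (not_le.mp hlt))

/-- The degree type `(|x₁|, …, |x_k|; |u₁|, …, |u_k|)`. -/
def degreeType (P : PositivelyElliptic) : List ℕ × List ℕ :=
  (List.ofFn P.deg, List.ofFn P.relDeg)

/-- The presentation is a pure model: generators and relations are ordered by degree, and every
monomial `x₁^{a₁} ⋯ x_k^{a_k}` that occurs in a relation has `a₁ + ⋯ + a_k ≥ 2`. (The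
inequalities `|u_i| ≥ 2 |x_i|` follow from this and from regularity; they are not assumed.) -/
structure IsPureModel (P : PositivelyElliptic) : Prop where
  deg_mono : Monotone P.deg
  relDeg_mono : Monotone P.relDeg
  two_le : ∀ i, ∀ a ∈ (P.rel i).support, 2 ≤ a.degree

/-- A derivation `δ` of `H` has degree `e ∈ ℤ` if `δ (H^n) ⊆ H^{n+e}` for all `n`. Since `H` is
concentrated in even degrees, the sign `(-1)^{|δ||x|}` in the graded Leibniz rule is always `1`,
so that graded derivations are ordinary derivations. -/
def HasDegree {P : PositivelyElliptic} (δ : Derivation ℚ P.Alg P.Alg) (e : ℤ) : Prop :=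
  ∀ (n : ℤ) (x : P.Alg), x ∈ P.pieceInt n → δ x ∈ P.pieceInt (n + e)

/-- `H` admits a non-zero derivation of negative degree. -/
def HasNegativeDerivation (P : PositivelyElliptic) : Prop :=
  ∃ (δ : Derivation ℚ P.Alg P.Alg) (e : ℤ), e < 0 ∧ HasDegree δ e ∧ δ ≠ 0

/-- A morphism of graded algebras. -/
def IsGraded {P R : PositivelyElliptic} (f : P.Alg →ₐ[ℚ] R.Alg) : Prop :=
  ∀ (n : ℕ) (x : P.Alg), x ∈ P.piece n → f x ∈ R.piece n

/-- Exactness of `0 → K → H → Q → 0` for graded augmented algebras: `K` embeds in `H` with `H` flat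
(equivalently, free) over `K`, and `H → Q` is the quotient by the ideal generated by the image of
`K⁺`. Flatness is what makes `dim H = dim K · dim Q` and `fd H = fd K + fd Q`; without it
`ℚ[x] / (x³)` would be an extension of `ℚ[x] / (x²)` by its subalgebra spanned by `1` and `x²`. -/
structure IsExact {K H Q : PositivelyElliptic} (f : K.Alg →ₐ[ℚ] H.Alg) (g : H.Alg →ₐ[ℚ] Q.Alg) :
    Prop where
  graded_left : IsGraded f
  graded_right : IsGraded g
  injective : Function.Injective f
  flat : f.toRingHom.Flat
  surjective : Function.Surjective g
  ker_eq : RingHom.ker g = K.augmentationIdeal.map f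

/-- `H` splits: there is an exact sequence `0 → K → H → Q → 0` of positively elliptic algebras in
which `K` and `Q` are non-zero as augmented algebras, that is, different from `ℚ`. -/
def Splits (H : PositivelyElliptic) : Prop :=
  ∃ (K Q : PositivelyElliptic) (f : K.Alg →ₐ[ℚ] H.Alg) (g : H.Alg →ₐ[ℚ] Q.Alg),
    K.augmentationIdeal ≠ ⊥ ∧ Q.augmentationIdeal ≠ ⊥ ∧ IsExact f g

end PositivelyElliptic

/-! Let `I` be the ideal of relations. Two facts about complete intersections carry the proof.

The first is Poincaré duality: the top degree of `H` is N = Σ|u_i| − Σ|x_i| (`quotientPiece_top`),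
and the socle is a line (`exists_sub_C_mul_mem_of_socle`). It obstructs derivations. Lift the given
one to a derivation D of the polynomial ring of degree −e with D(I) ⊆ I. Everything of degree N + e
lies in `I`, so D never hits the top class modulo `I`. But suppose that, after multiplication by an
element killed by D, all D(x_j) become multiples c_j σ of one σ ∉ I, with some c_j ≠ 0. Then Σ c_j
∂_j is surjective on polynomials, and D does hit the top class
(`false_of_mul_derivation_X_sub_mem`).

The second is Krull's height theorem: a space of polynomials without constant term generating an
ideal that contains all relations has dimension at least k (`le_finrank_of_rel_mem`).

By the obstruction D moves at least two variables, so the bound 8 leaves only generators of degrees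
2 and 4, and D sends those of degree 4 to linear forms in those of degree 2. Let a, b count the
generators of degree 2, 4; p, q the relations of degree 4, 6; s, t the relations whose degree is a
multiple of 4 that is at least 8, 12. Let r be the rank of D on linear forms and d the dimension of
D² applied to the span of the relations of degree 8. Then 2 ≤ r ≤ min(a, b), b ≤ s
(`card_deg_four_le`), r ≤ t + d (`rank_le`), d ≤ min(p, q), p + q ≤ r if p = q = d
(`card_add_card_le_rank`), and a = p = 2 is impossible (`false_of_card_eq_two`).

If the formal dimension is at most 20, then a + q + 2s + 2t ≤ 10. Together these force b = s = 2, q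
= t = 1, p = k − 3 and k = 4 or 5, and the sum of the relation degrees fixes the rest. The type with
relations 4, 8, 8, 12 does not survive: there q = 0, so d = 0 and r ≤ t = 1. -/

/-! ### Hilbert series of graded complete intersections -/

section HilbertSeries

variable {k : ℕ}

/-- The image in `ℚ[x₁, …, x_k] / J` of the polynomials that are homogeneous of degree `n`. -/
noncomputable def quotientPiece (w : Fin k → ℕ) (J : Ideal (MvPolynomial (Fin k) ℚ)) (n : ℕ) :
    Submodule ℚ (MvPolynomial (Fin k) ℚ ⧸ J) :=
  (weightedHomogeneousSubmodule ℚ w n).map (Ideal.Quotient.mkₐ ℚ J).toLinearMap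

theorem mem_quotientPiece {w : Fin k → ℕ} {J : Ideal (MvPolynomial (Fin k) ℚ)} {n : ℕ}
    {x : MvPolynomial (Fin k) ℚ ⧸ J} :
    x ∈ quotientPiece w J n ↔
      ∃ f, IsWeightedHomogeneous w f n ∧ Ideal.Quotient.mk J f = x := by
  simp [quotientPiece, Submodule.mem_map, mem_weightedHomogeneousSubmodule]

theorem finite_quotientPiece {w : Fin k → ℕ} (hw : ∀ i, 0 < w i)
    (J : Ideal (MvPolynomial (Fin k) ℚ)) (n : ℕ) : Module.Finite ℚ (quotientPiece w J n) :=
  Module.Finite.iff_fg.mpr ((weightedHomogeneousSubmodule_fg ℚ w (fun i => (hw i).ne') n).map _)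

/-- An ideal is graded if it contains the homogeneous components of its elements. -/
def IsGradedIdeal (w : Fin k → ℕ) (J : Ideal (MvPolynomial (Fin k) ℚ)) : Prop :=
  ∀ f ∈ J, ∀ n, weightedHomogeneousComponent w n f ∈ J

theorem weightedHomogeneousComponent_mul_of_isWeightedHomogeneous {w : Fin k → ℕ}
    {u : MvPolynomial (Fin k) ℚ} {d : ℕ} (hu : IsWeightedHomogeneous w u d)
    (g : MvPolynomial (Fin k) ℚ) (n : ℕ) :
    weightedHomogeneousComponent w n (g * u) =
      if d ≤ n then weightedHomogeneousComponent w (n - d) g * u else 0 := by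
  classical
  have hsum : g = ∑ᶠ m, weightedHomogeneousComponent w m g :=
    (finsum_weightedHomogeneousComponent w g).symm
  have hfin := weightedHomogeneousComponent_finsupp (w := w) g
  have h1 : g * u = ∑ m ∈ hfin.toFinset, weightedHomogeneousComponent w m g * u := by
    conv_lhs => rw [hsum, finsum_eq_sum _ hfin]
    rw [Finset.sum_mul]
  rw [h1, map_sum]
  have h2 : ∀ m, weightedHomogeneousComponent w n (weightedHomogeneousComponent w m g * u) =
      if n = m + d then weightedHomogeneousComponent w m g * u else 0 := fun m =>
    weightedHomogeneousComponent_of_mem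
      ((mem_weightedHomogeneousSubmodule ℚ w (m + d) _).mpr
        ((weightedHomogeneousComponent_isWeightedHomogeneous m g).mul hu))
  simp_rw [h2]
  split_ifs with hd
  · rw [Finset.sum_eq_single (n - d)]
    · rw [if_pos (by omega)]
    · intro m _ hm
      rw [if_neg (by omega)]
    · intro hm
      rw [if_pos (by omega)]
      have : weightedHomogeneousComponent w (n - d) g = 0 := by
        by_contra h0
        exact hm (hfin.mem_toFinset.mpr h0)
      rw [this, zero_mul]
  · exact Finset.sum_eq_zero fun m _ => if_neg (by omega)

theorem isGradedIdeal_bot (w : Fin k → ℕ) : IsGradedIdeal w ⊥ := by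
  intro f hf n
  rw [Ideal.mem_bot.mp hf, map_zero]
  exact Ideal.zero_mem _

theorem IsGradedIdeal.sup_span_singleton {w : Fin k → ℕ} {J : Ideal (MvPolynomial (Fin k) ℚ)}
    (hJ : IsGradedIdeal w J) {u : MvPolynomial (Fin k) ℚ} {d : ℕ}
    (hu : IsWeightedHomogeneous w u d) : IsGradedIdeal w (J ⊔ Ideal.span {u}) := by
  intro f hf n
  obtain ⟨a, ha, b, hb, rfl⟩ := Submodule.mem_sup.mp hf
  obtain ⟨g, rfl⟩ := Ideal.mem_span_singleton'.mp hb
  rw [map_add, weightedHomogeneousComponent_mul_of_isWeightedHomogeneous hu]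
  refine Ideal.add_mem _ (Ideal.mem_sup_left (hJ a ha n)) (Ideal.mem_sup_right ?_)
  split_ifs
  · exact Ideal.mul_mem_left _ _ (Ideal.mem_span_singleton_self u)
  · exact Ideal.zero_mem _

/-- The effect on the Hilbert function of dividing by a regular homogeneous element. -/
theorem finrank_quotientPiece_sup_span_singleton {w : Fin k → ℕ} (hw : ∀ i, 0 < w i)
    {J : Ideal (MvPolynomial (Fin k) ℚ)} (hJ : IsGradedIdeal w J)
    {u : MvPolynomial (Fin k) ℚ} {d : ℕ} (hu : IsWeightedHomogeneous w u d)
    (hreg : ∀ f, u * f ∈ J → f ∈ J) (n : ℕ) :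
    Module.finrank ℚ (quotientPiece w (J ⊔ Ideal.span {u}) n) +
      (if d ≤ n then Module.finrank ℚ (quotientPiece w J (n - d)) else 0) =
    Module.finrank ℚ (quotientPiece w J n) := by
  classical
  have := finite_quotientPiece hw J
  let π : (MvPolynomial (Fin k) ℚ ⧸ J) →ₗ[ℚ] (MvPolynomial (Fin k) ℚ ⧸ J ⊔ Ideal.span {u}) :=
    (Ideal.Quotient.factorₐ ℚ (le_sup_left : J ≤ J ⊔ Ideal.span {u})).toLinearMap
  let φ := π.domRestrict (quotientPiece w J n)
  have hrange : LinearMap.range φ = quotientPiece w (J ⊔ Ideal.span {u}) n := by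
    ext y
    rw [LinearMap.mem_range, mem_quotientPiece]
    constructor
    · rintro ⟨⟨x, hx⟩, rfl⟩
      obtain ⟨f, hf, rfl⟩ := mem_quotientPiece.mp hx
      exact ⟨f, hf, rfl⟩
    · rintro ⟨f, hf, rfl⟩
      exact ⟨⟨Ideal.Quotient.mk J f, mem_quotientPiece.mpr ⟨f, hf, rfl⟩⟩, rfl⟩
  have hker : Module.finrank ℚ (LinearMap.ker φ) =
      if d ≤ n then Module.finrank ℚ (quotientPiece w J (n - d)) else 0 := by
    -- Taking components of degree `n` makes the cofactor of `u` homogeneous, and keeps the other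
    -- summand in `J` because `J` is graded.
    have hcomp : ∀ f, IsWeightedHomogeneous w f n → f ∈ J ⊔ Ideal.span {u} →
        f ∈ J ∨ ∃ a ∈ J, ∃ g, d ≤ n ∧ IsWeightedHomogeneous w g (n - d) ∧ f = a + g * u := by
      intro f hf hmem
      obtain ⟨a, ha, b, hb, hab⟩ := Submodule.mem_sup.mp hmem
      obtain ⟨g, rfl⟩ := Ideal.mem_span_singleton'.mp hb
      have h1 : f = weightedHomogeneousComponent w n a +
          weightedHomogeneousComponent w n (g * u) := by
        rw [← map_add, hab, hf.weightedHomogeneousComponent_same]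
      rw [weightedHomogeneousComponent_mul_of_isWeightedHomogeneous hu] at h1
      split_ifs at h1 with hd
      · exact Or.inr ⟨_, hJ a ha n, _, hd,
          weightedHomogeneousComponent_isWeightedHomogeneous _ _, h1⟩
      · rw [add_zero] at h1
        exact Or.inl (h1 ▸ hJ a ha n)
    split_ifs with hd
    · let μ : (MvPolynomial (Fin k) ℚ ⧸ J) →ₗ[ℚ] (MvPolynomial (Fin k) ℚ ⧸ J) :=
        LinearMap.mulLeft ℚ (Ideal.Quotient.mk J u)
      have hμ : Function.Injective μ := by
        rw [← LinearMap.ker_eq_bot, LinearMap.ker_eq_bot']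
        intro x hx
        obtain ⟨f, rfl⟩ := Ideal.Quotient.mk_surjective x
        rw [LinearMap.mulLeft_apply, ← map_mul, Ideal.Quotient.eq_zero_iff_mem] at hx
        exact Ideal.Quotient.eq_zero_iff_mem.mpr (hreg f hx)
      -- The kernel is `u` times the piece of degree `n - d`, and multiplication by `u` is injective
      -- by regularity.
      have hmap : (LinearMap.ker φ).map (quotientPiece w J n).subtype =
          (quotientPiece w J (n - d)).map μ := by
        ext y
        simp only [Submodule.mem_map, LinearMap.mem_ker, Submodule.subtype_apply]
        constructor
        · rintro ⟨⟨x, hx⟩, hx0, rfl⟩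
          obtain ⟨f, hf, rfl⟩ := mem_quotientPiece.mp hx
          have h0 : f ∈ J ⊔ Ideal.span {u} := Ideal.Quotient.eq_zero_iff_mem.mp hx0
          obtain h | ⟨a, ha, g, -, hg, h⟩ := hcomp f hf h0
          · refine ⟨0, Submodule.zero_mem _, ?_⟩
            simpa using (Ideal.Quotient.eq_zero_iff_mem.mpr h).symm
          · refine ⟨Ideal.Quotient.mk J g, mem_quotientPiece.mpr ⟨g, hg, rfl⟩, ?_⟩
            change Ideal.Quotient.mk J u * Ideal.Quotient.mk J g = Ideal.Quotient.mk J f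
            rw [← map_mul, h, map_add,
              Ideal.Quotient.eq_zero_iff_mem.mpr ha, zero_add, mul_comm]
        · rintro ⟨x, hx, rfl⟩
          obtain ⟨g, hg, rfl⟩ := mem_quotientPiece.mp hx
          refine ⟨⟨Ideal.Quotient.mk J (u * g), mem_quotientPiece.mpr ⟨u * g, ?_, rfl⟩⟩, ?_, ?_⟩
          · have := hu.mul hg
            rwa [Nat.add_sub_cancel' hd] at this
          · exact Ideal.Quotient.eq_zero_iff_mem.mpr (Ideal.mem_sup_right
              (Ideal.mul_mem_right _ _ (Ideal.mem_span_singleton_self u)))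
          · simp [μ]
      rw [(Submodule.equivMapOfInjective μ hμ (quotientPiece w J (n - d))).finrank_eq, ← hmap]
      exact (Submodule.equivMapOfInjective _ (Submodule.injective_subtype _) _).finrank_eq
    · have : LinearMap.ker φ = ⊥ := by
        rw [LinearMap.ker_eq_bot']
        rintro ⟨x, hx⟩ hx0
        obtain ⟨f, hf, rfl⟩ := mem_quotientPiece.mp hx
        have h0 : f ∈ J ⊔ Ideal.span {u} := Ideal.Quotient.eq_zero_iff_mem.mp hx0
        obtain h | ⟨a, ha, g, hd', -⟩ := hcomp f hf h0
        · exact Subtype.ext (Ideal.Quotient.eq_zero_iff_mem.mpr h)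
        · exact absurd hd' hd
      rw [this, finrank_bot]
  rw [← hrange, ← hker, LinearMap.finrank_range_add_finrank_ker]

end HilbertSeries

section HilbertSeries

variable {k : ℕ}

/-- The Hilbert series of `ℚ[x₁, …, x_k] / J`. -/
noncomputable def hilbertSeries (w : Fin k → ℕ) (J : Ideal (MvPolynomial (Fin k) ℚ)) :
    PowerSeries ℤ :=
  PowerSeries.mk fun n => (Module.finrank ℚ (quotientPiece w J n) : ℤ)

theorem hilbertSeries_sup_span_singleton {w : Fin k → ℕ} (hw : ∀ i, 0 < w i)
    {J : Ideal (MvPolynomial (Fin k) ℚ)} (hJ : IsGradedIdeal w J)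
    {u : MvPolynomial (Fin k) ℚ} {d : ℕ} (hu : IsWeightedHomogeneous w u d)
    (hreg : ∀ f, u * f ∈ J → f ∈ J) :
    hilbertSeries w (J ⊔ Ideal.span {u}) = (1 - PowerSeries.X ^ d) * hilbertSeries w J := by
  ext n
  have h := finrank_quotientPiece_sup_span_singleton hw hJ hu hreg n
  rw [sub_mul, one_mul, map_sub, PowerSeries.coeff_X_pow_mul']
  simp only [hilbertSeries, PowerSeries.coeff_mk]
  split_ifs at h ⊢ <;> omega

theorem span_range_eq_sup_span_last {m : ℕ} (u : Fin (m + 1) → MvPolynomial (Fin k) ℚ) :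
    Ideal.span (Set.range u) =
      Ideal.span (Set.range fun i : Fin m => u i.castSucc) ⊔ Ideal.span {u (Fin.last m)} := by
  rw [← Ideal.span_union]
  congr 1
  ext x
  simp only [Set.mem_range, Set.mem_union, Set.mem_singleton_iff]
  constructor
  · rintro ⟨i, rfl⟩
    induction i using Fin.lastCases with
    | last => exact Or.inr rfl
    | cast i => exact Or.inl ⟨i, rfl⟩
  · rintro (⟨i, rfl⟩ | rfl)
    · exact ⟨_, rfl⟩
    · exact ⟨_, rfl⟩

theorem ofList_ofFn {m : ℕ} (u : Fin m → MvPolynomial (Fin k) ℚ) :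
    Ideal.ofList (List.ofFn u) = Ideal.span (Set.range u) := by
  rw [Ideal.ofList]
  congr 1
  ext x
  simp [List.mem_ofFn]

theorem isWeaklyRegular_ofFn_succ {m : ℕ} {u : Fin (m + 1) → MvPolynomial (Fin k) ℚ} :
    RingTheory.Sequence.IsWeaklyRegular (MvPolynomial (Fin k) ℚ) (List.ofFn u) ↔
      RingTheory.Sequence.IsWeaklyRegular (MvPolynomial (Fin k) ℚ)
        (List.ofFn fun i : Fin m => u i.castSucc) ∧
      ∀ f, u (Fin.last m) * f ∈ Ideal.span (Set.range fun i : Fin m => u i.castSucc) →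
        f ∈ Ideal.span (Set.range fun i : Fin m => u i.castSucc) := by
  rw [List.ofFn_succ', List.concat_eq_append, RingTheory.Sequence.isWeaklyRegular_append_iff,
    RingTheory.Sequence.isWeaklyRegular_singleton_iff, isSMulRegular_quotient_iff_mem_of_smul_mem,
    ofList_ofFn]
  simp

theorem hilbertSeries_span_range {w : Fin k → ℕ} (hw : ∀ i, 0 < w i) {m : ℕ}
    {u : Fin m → MvPolynomial (Fin k) ℚ} {d : Fin m → ℕ}
    (hu : ∀ i, IsWeightedHomogeneous w (u i) (d i))
    (hreg : RingTheory.Sequence.IsWeaklyRegular (MvPolynomial (Fin k) ℚ) (List.ofFn u)) :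
    IsGradedIdeal w (Ideal.span (Set.range u)) ∧
      hilbertSeries w (Ideal.span (Set.range u)) =
        (∏ i, (1 - PowerSeries.X ^ d i)) * hilbertSeries w ⊥ := by
  induction m with
  | zero =>
    have : Set.range u = ∅ := Set.range_eq_empty u
    simp [this, isGradedIdeal_bot]
  | succ m ih =>
    obtain ⟨h1, h2⟩ := isWeaklyRegular_ofFn_succ.mp hreg
    obtain ⟨hg, hs⟩ := ih (d := fun i => d i.castSucc) (fun i => hu i.castSucc) h1
    rw [span_range_eq_sup_span_last]
    refine ⟨hg.sup_span_singleton (hu _), ?_⟩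
    rw [hilbertSeries_sup_span_singleton hw hg (hu _) h2, hs, Fin.prod_univ_castSucc]
    ring

/-- Membership in an ideal generated by variables is tested monomial by monomial, and multiplying by
a new variable does not affect the test. -/
theorem isWeaklyRegular_ofFn_X {m : ℕ} {g : Fin m → Fin k} (hg : Function.Injective g) :
    RingTheory.Sequence.IsWeaklyRegular (MvPolynomial (Fin k) ℚ)
      (List.ofFn fun i => (X (g i) : MvPolynomial (Fin k) ℚ)) := by
  induction m with
  | zero => simp
  | succ m ih =>
    rw [isWeaklyRegular_ofFn_succ]
    refine ⟨ih (g := fun i => g i.castSucc)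
      (hg.comp (Fin.castSucc_injective m)), fun f hf => ?_⟩
    have himage : (Set.range fun i : Fin m => (X (g i.castSucc) : MvPolynomial (Fin k) ℚ)) =
        X '' Set.range fun i : Fin m => g i.castSucc := by
      ext x; simp
    rw [himage] at hf ⊢
    rw [mem_ideal_span_X_image] at hf ⊢
    intro a ha
    obtain ⟨_, ⟨i, rfl⟩, hi⟩ := hf (Finsupp.single (g (Fin.last m)) 1 + a) (by
      rw [mem_support_iff, coeff_X_mul]
      exact mem_support_iff.mp ha)
    refine ⟨_, ⟨i, rfl⟩, ?_⟩
    have hne : g (Fin.last m) ≠ g i.castSucc := fun h =>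
      (Fin.castSucc_lt_last i).ne' (hg h)
    simpa [Finsupp.single_apply, hne] using hi

theorem isRegular_ofFn_X :
    RingTheory.Sequence.IsRegular (MvPolynomial (Fin k) ℚ)
      (List.ofFn (X : Fin k → MvPolynomial (Fin k) ℚ)) := by
  refine ⟨isWeaklyRegular_ofFn_X (g := id) Function.injective_id, fun h => ?_⟩
  rw [ofList_ofFn, smul_eq_mul, Ideal.mul_top] at h
  have h1 : (1 : MvPolynomial (Fin k) ℚ) ∈ Ideal.span (X '' (Set.univ : Set (Fin k))) := by
    rw [Set.image_univ, ← h]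
    trivial
  rw [mem_ideal_span_X_image] at h1
  obtain ⟨i, -, hi⟩ := h1 0 (by simp)
  exact hi rfl

theorem hilbertSeries_span_range_X {w : Fin k → ℕ} (hw : ∀ i, 0 < w i) :
    hilbertSeries w (Ideal.span (Set.range (X : Fin k → MvPolynomial (Fin k) ℚ))) = 1 := by
  classical
  have hX : (X '' (Set.univ : Set (Fin k)) : Set (MvPolynomial (Fin k) ℚ)) = Set.range X :=
    Set.image_univ
  ext n
  rw [hilbertSeries, PowerSeries.coeff_mk, PowerSeries.coeff_one]
  split_ifs with hn
  · subst hn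
    norm_cast
    rw [finrank_eq_one_iff']
    refine ⟨⟨Ideal.Quotient.mk _ 1, mem_quotientPiece.mpr
      ⟨1, isWeightedHomogeneous_one ℚ w, rfl⟩⟩, ?_, ?_⟩
    · intro h
      have h1 := Ideal.Quotient.eq_zero_iff_mem.mp (congrArg Subtype.val h)
      rw [← hX, mem_ideal_span_X_image] at h1
      obtain ⟨i, -, hi⟩ := h1 0 (by simp)
      exact hi rfl
    · rintro ⟨x, hx⟩
      obtain ⟨f, hf, rfl⟩ := mem_quotientPiece.mp hx
      refine ⟨coeff 0 f, Subtype.ext ?_⟩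
      change coeff 0 f • Ideal.Quotient.mk _ 1 = Ideal.Quotient.mk _ f
      rw [← Ideal.Quotient.mkₐ_eq_mk ℚ, ← map_smul, Ideal.Quotient.mkₐ_eq_mk, Ideal.Quotient.eq,
        ← hX, mem_ideal_span_X_image]
      intro a ha
      by_contra! h0
      have : a = 0 := Finsupp.ext fun i => h0 i trivial
      subst this
      simp [mem_support_iff] at ha
  · norm_cast
    have := finite_quotientPiece hw
    apply Submodule.finrank_eq_zero.mpr ((Submodule.eq_bot_iff _).mpr _)
    intro x hx
    obtain ⟨f, hf, rfl⟩ := mem_quotientPiece.mp hx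
    rw [Ideal.Quotient.eq_zero_iff_mem, ← hX, mem_ideal_span_X_image]
    intro a ha
    by_contra! h0
    have : a = 0 := Finsupp.ext fun i => h0 i trivial
    subst this
    exact hn (by simpa using (hf (mem_support_iff.mp ha)).symm)

open Polynomial in
/-- The polynomial `∏ (1 + t + ⋯ + t^{d_i - 1})`. -/
noncomputable def prodGeomSum {m : ℕ} (d : Fin m → ℕ) : ℤ[X] :=
  ∏ i, ∑ j ∈ Finset.range (d i), Polynomial.X ^ j

theorem prodGeomSum_monic {m : ℕ} {d : Fin m → ℕ} (hd : ∀ i, 0 < d i) :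
    (prodGeomSum d).Monic :=
  Polynomial.monic_prod_of_monic _ _ fun i _ => Polynomial.monic_geom_sum_X (hd i).ne'

theorem prodGeomSum_natDegree {m : ℕ} {d : Fin m → ℕ} (hd : ∀ i, 0 < d i) :
    (prodGeomSum d).natDegree + m = ∑ i, d i := by
  rw [prodGeomSum, Polynomial.natDegree_prod_of_monic _ _
    fun i _ => Polynomial.monic_geom_sum_X (hd i).ne']
  have h : ∀ i, (∑ j ∈ Finset.range (d i), (Polynomial.X : Polynomial ℤ) ^ j).natDegree + 1 =
      d i := fun i => by
    obtain ⟨n, hn⟩ := Nat.exists_eq_succ_of_ne_zero (hd i).ne'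
    have hm := Polynomial.monic_geom_sum_X (R := ℤ) (n := n + 1) n.succ_ne_zero
    have h2 : ((Polynomial.X : Polynomial ℤ) - Polynomial.C 1).Monic := Polynomial.monic_X_sub_C 1
    have h1 := hm.natDegree_mul h2
    rw [map_one, geom_sum_mul, ← Polynomial.C_1, Polynomial.natDegree_X_sub_C] at h1
    rw [Polynomial.natDegree_X_pow_sub_C] at h1
    rw [hn, Nat.succ_eq_add_one, ← h1]
  calc _ = ∑ i, ((∑ j ∈ Finset.range (d i), (Polynomial.X : Polynomial ℤ) ^ j).natDegree + 1) := by
        rw [Finset.sum_add_distrib]; simp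
    _ = _ := Finset.sum_congr rfl fun i _ => h i

theorem coe_prodGeomSum {m : ℕ} (d : Fin m → ℕ) :
    (1 - PowerSeries.X) ^ m * (prodGeomSum d : PowerSeries ℤ) =
      ∏ i, (1 - PowerSeries.X ^ d i) := by
  have : (prodGeomSum d : PowerSeries ℤ) =
      ∏ i, ∑ j ∈ Finset.range (d i), (PowerSeries.X : PowerSeries ℤ) ^ j := by
    rw [← Polynomial.coeToPowerSeries.ringHom_apply, prodGeomSum, map_prod]
    simp
  rw [this]
  have hc : (1 - PowerSeries.X : PowerSeries ℤ) ^ m = ∏ _i : Fin m, (1 - PowerSeries.X) := by simp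
  rw [hc, ← Finset.prod_mul_distrib]
  exact Finset.prod_congr rfl fun i _ => mul_neg_geom_sum _ _

/-- The formula for regular sequences is used twice: for `u`, and for the variables, whose quotient
has series 1. This eliminates the series of the polynomial ring, and (1 − t)^k cancels, leaving
monic polynomials. -/
theorem hilbertSeries_mul_prodGeomSum {w : Fin k → ℕ} (hw : ∀ i, 0 < w i)
    {u : Fin k → MvPolynomial (Fin k) ℚ} {d : Fin k → ℕ}
    (hu : ∀ i, IsWeightedHomogeneous w (u i) (d i))
    (hreg : RingTheory.Sequence.IsWeaklyRegular (MvPolynomial (Fin k) ℚ) (List.ofFn u)) :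
    hilbertSeries w (Ideal.span (Set.range u)) * (prodGeomSum w : PowerSeries ℤ) =
      prodGeomSum d := by
  have h1 := (hilbertSeries_span_range hw hu hreg).2
  have h2 := (hilbertSeries_span_range hw (fun i => isWeightedHomogeneous_X ℚ w i)
    isRegular_ofFn_X.toIsWeaklyRegular).2
  rw [hilbertSeries_span_range_X hw, ← coe_prodGeomSum] at h2
  rw [← coe_prodGeomSum] at h1
  have h0 : (1 - PowerSeries.X : PowerSeries ℤ) ^ k ≠ 0 := by
    refine pow_ne_zero _ fun h => ?_
    have := congrArg (PowerSeries.coeff 0) h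
    simp at this
  apply mul_left_cancel₀ h0
  rw [h1]
  linear_combination (-(1 - PowerSeries.X) ^ k * (prodGeomSum d : PowerSeries ℤ)) * h2

/-- A graded complete intersection has finite dimension, and its top degree piece is a line. -/
theorem quotientPiece_top {w : Fin k → ℕ} (hw : ∀ i, 0 < w i)
    {u : Fin k → MvPolynomial (Fin k) ℚ} {d : Fin k → ℕ} (hd : ∀ i, 0 < d i)
    (hu : ∀ i, IsWeightedHomogeneous w (u i) (d i))
    (hreg : RingTheory.Sequence.IsWeaklyRegular (MvPolynomial (Fin k) ℚ) (List.ofFn u)) :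
    ∃ N, N + ∑ i, w i = ∑ i, d i ∧
      (∀ n, N < n → quotientPiece w (Ideal.span (Set.range u)) n = ⊥) ∧
      Module.finrank ℚ (quotientPiece w (Ideal.span (Set.range u)) N) = 1 := by
  set I := Ideal.span (Set.range u)
  have hfin := finite_quotientPiece hw I
  have hmul := hilbertSeries_mul_prodGeomSum hw hu hreg
  set F := prodGeomSum w
  set G := prodGeomSum d
  have hFn : ∀ n, 0 ≤ F.coeff n := fun n => by
    have : F = (∏ i, ∑ j ∈ Finset.range (w i), (Polynomial.X : Polynomial ℕ) ^ j).map
        (Nat.castRingHom ℤ) := by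
      simp [F, prodGeomSum, Polynomial.map_prod, Polynomial.map_sum]
    rw [this, Polynomial.coeff_map]
    simp
  have hF0 : 1 ≤ F.coeff 0 := by
    have : F.coeff 0 = 1 := by
      rw [Polynomial.coeff_zero_eq_eval_zero]
      simp only [F, prodGeomSum, Polynomial.eval_prod, Polynomial.eval_finsetSum,
        Polynomial.eval_pow, Polynomial.eval_X]
      refine Finset.prod_eq_one fun i _ => ?_
      rw [Finset.sum_eq_single 0]
      · simp
      · intro j _ hj
        simp [hj]
      · intro h
        exact absurd (Finset.mem_range.mpr (hw i)) h
    exact this.ge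
  -- `F` has non-negative coefficients and constant term at least 1, so the Hilbert series is
  -- dominated by the polynomial `G` and is itself a polynomial.
  have hbound : ∀ n, (Module.finrank ℚ (quotientPiece w I n) : ℤ) ≤ G.coeff n := fun n => by
    have h := congrArg (PowerSeries.coeff n) hmul
    rw [Polynomial.coeff_coe, PowerSeries.coeff_mul] at h
    rw [← h]
    have hterm : ∀ p ∈ Finset.HasAntidiagonal.antidiagonal n, 0 ≤ PowerSeries.coeff p.1 (hilbertSeries w I) *
        PowerSeries.coeff p.2 (F : PowerSeries ℤ) := fun p _ => by
      rw [hilbertSeries, PowerSeries.coeff_mk, Polynomial.coeff_coe]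
      exact mul_nonneg (by positivity) (hFn _)
    refine le_trans ?_ (Finset.single_le_sum hterm (a := (n, 0)) (by simp))
    rw [hilbertSeries, PowerSeries.coeff_mk, Polynomial.coeff_coe]
    exact le_mul_of_one_le_right (by positivity) hF0
  have hzero : ∀ n, G.natDegree < n → Module.finrank ℚ (quotientPiece w I n) = 0 := fun n hn => by
    have := hbound n
    rw [Polynomial.coeff_eq_zero_of_natDegree_lt hn] at this
    omega
  set p : Polynomial ℤ := (hilbertSeries w I).trunc (G.natDegree + 1)
  have hp : (p : PowerSeries ℤ) = hilbertSeries w I := by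
    ext n
    rw [Polynomial.coeff_coe, PowerSeries.coeff_trunc]
    split_ifs with h
    · rfl
    · rw [hilbertSeries, PowerSeries.coeff_mk, hzero n (by omega)]
      rfl
  have hcoeff : ∀ n, p.coeff n = (Module.finrank ℚ (quotientPiece w I n) : ℤ) := fun n => by
    rw [← Polynomial.coeff_coe, hp, hilbertSeries, PowerSeries.coeff_mk]
  have hpFG : p * F = G := by
    apply Polynomial.coe_injective
    rw [Polynomial.coe_mul, hp, hmul]
  have hFm : F.Monic := prodGeomSum_monic hw
  have hGm : G.Monic := prodGeomSum_monic hd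
  -- The leading coefficient is the dimension of the top piece.
  have hpm : p.Monic := hFm.of_mul_monic_right (hpFG ▸ hGm)
  have hdeg := hpm.natDegree_mul hFm
  rw [hpFG] at hdeg
  have hF := prodGeomSum_natDegree hw
  have hG := prodGeomSum_natDegree hd
  refine ⟨p.natDegree, ?_, fun n hn => ?_, ?_⟩
  · rw [← hF, ← hG, ← add_assoc, ← hdeg]
  · apply Submodule.finrank_eq_zero.mp
    have := hcoeff n
    rw [Polynomial.coeff_eq_zero_of_natDegree_lt hn] at this
    omega
  · have := hcoeff p.natDegree
    rw [hpm.coeff_natDegree] at this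
    omega

end HilbertSeries

/-! ### The socle of a complete intersection, via Ext -/

section Socle

open CategoryTheory Abelian RingTheory.Sequence

/-- If a regular sequence of length `n` on `M` annihilates `N`, then
`Extⁿ(N, M) = Hom(N, M / (r₁, …, r_n) M)`. -/
theorem nonempty_ext_addEquiv_of_isRegular {R : Type} [CommRing R] [IsNoetherianRing R]
    (N : ModuleCat.{0} R) [Module.Finite R N] (rs : List R)
    (hN : ∀ r ∈ rs, r ∈ Module.annihilator R N) {n : ℕ} (hn : rs.length = n)
    (M : ModuleCat.{0} R) [Module.Finite R M] (hreg : IsRegular M rs) :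
    Nonempty (Ext N M n ≃+ (N →ₗ[R] (M ⧸ (Ideal.ofList rs • ⊤ : Submodule R M)))) := by
  induction n generalizing M rs with
  | zero =>
    obtain rfl := List.length_eq_zero_iff.mp hn
    let e : M ≃ₗ[R] (M ⧸ (Ideal.ofList ([] : List R) • ⊤ : Submodule R M)) :=
      (Submodule.quotEquivOfEqBot _ (by
        rw [Ideal.ofList_nil (R := R)]
        exact Submodule.bot_smul _)).symm
    exact ⟨(Ext.addEquiv₀.trans ModuleCat.homAddEquiv).trans
      (LinearEquiv.congrRight e).toAddEquiv⟩
  | succ n ih =>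
    obtain _ | ⟨r, rs⟩ := rs
    · simp at hn
    have hlen : rs.length = n := by simpa using hn
    obtain ⟨hr, hrs⟩ := (isRegular_cons_iff M r rs).mp hreg
    let M' := ModuleCat.of R (QuotSMulTop r M)
    obtain ⟨e⟩ := ih rs (fun s hs => hN s (List.mem_cons_of_mem _ hs)) hlen M' hrs
    have hS := hr.smulShortComplex_shortExact
    -- Ext vanishes below the length of a regular sequence that annihilates `N`, and `r` acts as
    -- zero on Ext. So in the long exact sequence of multiplication by `r` the connecting map is
    -- bijective.
    have hsub : Subsingleton (Ext N M n) := by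
      refine ModuleCat.subsingleton_ext_of_exists_isRegular (Ideal.ofList (r :: rs)) N ?_ M
        (lt_top_iff_ne_top.mpr fun h => hreg.top_ne_smul h.symm) (r :: rs)
        (fun s hs => Ideal.subset_span hs) hreg n (by simp [hlen])
      rw [Module.support_eq_zeroLocus]
      exact PrimeSpectrum.zeroLocus_anti_mono
        (SetLike.coe_subset_coe.mpr (Ideal.span_le.mpr fun s hs => hN s hs))
    have hzero := Ext.postcomp_smul_id_eq_zero_of_mem_annihilator (M := M)
      (hN r List.mem_cons_self) (n + 1)
    let φ : Ext N M' n →+ Ext N M (n + 1) := hS.extClass.postcomp N rfl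
    have hinj : Function.Injective φ := by
      rw [injective_iff_map_eq_zero]
      intro x hx
      obtain ⟨y, rfl⟩ := Ext.covariant_sequence_exact₃ N hS x rfl hx
      rw [hsub.elim y 0]
      exact Ext.zero_comp _ _ _ _ _
    have hsurj : Function.Surjective φ := by
      intro x
      refine Ext.covariant_sequence_exact₁ N hS x ?_ rfl
      have := congrArg (fun f => (AddCommGrpCat.Hom.hom f) x) hzero
      simpa using! this
    exact ⟨((AddEquiv.ofBijective φ ⟨hinj, hsurj⟩).symm.trans e).trans
      (LinearEquiv.congrRight
        (Submodule.quotOfListConsSMulTopEquivQuotSMulTopInner M r rs).symm).toAddEquiv⟩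

/-- Both sides are Extⁿ(R/𝔪, R) for the common length n. This lets the socle of a complete
intersection be compared with that of the quotient by the variables. -/
theorem nonempty_hom_addEquiv_of_isRegular {R : Type} [CommRing R] [IsNoetherianRing R]
    (𝔪 : Ideal R) {rs rs' : List R} (h : IsRegular R rs) (h' : IsRegular R rs')
    (hm : ∀ r ∈ rs, r ∈ 𝔪) (hm' : ∀ r ∈ rs', r ∈ 𝔪) (hlen : rs.length = rs'.length) :
    Nonempty (((R ⧸ 𝔪) →ₗ[R] (R ⧸ Ideal.ofList rs)) ≃+ ((R ⧸ 𝔪) →ₗ[R] (R ⧸ Ideal.ofList rs'))) := by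
  have hann : ∀ rs : List R, (∀ r ∈ rs, r ∈ 𝔪) →
      ∀ r ∈ rs, r ∈ Module.annihilator R (ModuleCat.of R (R ⧸ 𝔪)) := by
    intro rs h r hr
    change r ∈ Module.annihilator R (R ⧸ 𝔪)
    rw [Ideal.annihilator_quotient]
    exact h r hr
  have htop : ∀ rs : List R, (Ideal.ofList rs • ⊤ : Submodule R R) = Ideal.ofList rs := fun rs => by
    rw [smul_eq_mul, Ideal.mul_top]
  obtain ⟨e⟩ := nonempty_ext_addEquiv_of_isRegular (ModuleCat.of R (R ⧸ 𝔪)) rs (hann rs hm)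
    hlen (ModuleCat.of R R) h
  obtain ⟨e'⟩ := nonempty_ext_addEquiv_of_isRegular (ModuleCat.of R (R ⧸ 𝔪)) rs' (hann rs' hm')
    rfl (ModuleCat.of R R) h'
  exact ⟨((LinearEquiv.congrRight (Submodule.quotEquivOfEq _ _ (htop rs)).symm).toAddEquiv.trans
    (e.symm.trans e')).trans
    (LinearEquiv.congrRight (Submodule.quotEquivOfEq _ _ (htop rs'))).toAddEquiv⟩

variable {k : ℕ}

theorem exists_sub_C_mem_idealOfVars (p : MvPolynomial (Fin k) ℚ) :
    p - C (coeff 0 p) ∈ idealOfVars (Fin k) ℚ := by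
  rw [← pow_one (idealOfVars (Fin k) ℚ), mem_pow_idealOfVars_iff']
  intro a ha
  obtain rfl : a = 0 := (Finsupp.degree_eq_zero_iff a).mp (by omega)
  simp

/-- The socle of a graded complete intersection is at most one-dimensional. -/
theorem exists_sub_C_mul_mem_of_socle {u : Fin k → MvPolynomial (Fin k) ℚ}
    (hreg : IsRegular (MvPolynomial (Fin k) ℚ) (List.ofFn u))
    (hu : ∀ i, u i ∈ idealOfVars (Fin k) ℚ) {f g : MvPolynomial (Fin k) ℚ}
    (hf : ∀ i, X i * f ∈ Ideal.span (Set.range u)) (hg : ∀ i, X i * g ∈ Ideal.span (Set.range u))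
    (hf0 : f ∉ Ideal.span (Set.range u)) :
    ∃ c : ℚ, g - C c * f ∈ Ideal.span (Set.range u) := by
  obtain ⟨e⟩ := nonempty_hom_addEquiv_of_isRegular (idealOfVars (Fin k) ℚ) hreg
    (isRegular_ofFn_X (k := k)) (by simpa [List.mem_ofFn] using hu) (by
      intro r hr
      obtain ⟨i, rfl⟩ := (List.mem_ofFn' _ _).mp hr
      exact Ideal.subset_span ⟨i, rfl⟩) (by simp)
  have hX : Ideal.ofList (List.ofFn (X : Fin k → MvPolynomial (Fin k) ℚ)) =
      idealOfVars (Fin k) ℚ := ofList_ofFn _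
  rw [hX, ofList_ofFn] at e
  set I := Ideal.span (Set.range u)
  -- For the variables the right-hand side is End(A/𝔪), which evaluation at 1 embeds in A/𝔪 = ℚ. A
  -- socle element, seen as a map A/𝔪 → A/I, is thus determined by one rational number.
  let ε : ((MvPolynomial (Fin k) ℚ ⧸ idealOfVars (Fin k) ℚ) →ₗ[MvPolynomial (Fin k) ℚ]
      (MvPolynomial (Fin k) ℚ ⧸ I)) →+ (MvPolynomial (Fin k) ℚ ⧸ idealOfVars (Fin k) ℚ) :=
    (LinearMap.applyₗ (R := MvPolynomial (Fin k) ℚ)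
      (Ideal.Quotient.mk (idealOfVars (Fin k) ℚ) 1)).toAddMonoidHom.comp e.toAddMonoidHom
  have hε : Function.Injective ε := by
    intro φ ψ h
    exact e.injective (Submodule.linearMap_qext _ (LinearMap.ext_ring h))
  have hsoc : ∀ h : MvPolynomial (Fin k) ℚ, (∀ i, X i * h ∈ I) →
      ∃ s : (MvPolynomial (Fin k) ℚ ⧸ idealOfVars (Fin k) ℚ) →ₗ[MvPolynomial (Fin k) ℚ]
        (MvPolynomial (Fin k) ℚ ⧸ I), s (Ideal.Quotient.mk _ 1) = Ideal.Quotient.mk I h := by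
    intro h hh
    have hle : idealOfVars (Fin k) ℚ ≤ LinearMap.ker
        (LinearMap.toSpanSingleton (MvPolynomial (Fin k) ℚ) _ (Ideal.Quotient.mk I h)) := by
      rw [idealOfVars, Ideal.span_le]
      rintro _ ⟨i, rfl⟩
      change (X i : MvPolynomial (Fin k) ℚ) • Ideal.Quotient.mk I h = 0
      exact Ideal.Quotient.eq_zero_iff_mem.mpr (hh i)
    refine ⟨Submodule.liftQ _ _ hle, ?_⟩
    change (1 : MvPolynomial (Fin k) ℚ) • Ideal.Quotient.mk I h = _
    rw [one_smul]
  have hconst : ∀ x : MvPolynomial (Fin k) ℚ ⧸ idealOfVars (Fin k) ℚ,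
      ∃ c : ℚ, x = c • Ideal.Quotient.mk _ 1 := by
    intro x
    obtain ⟨p, rfl⟩ := Ideal.Quotient.mk_surjective x
    refine ⟨coeff 0 p, ?_⟩
    rw [← Ideal.Quotient.mkₐ_eq_mk ℚ (idealOfVars (Fin k) ℚ), ← map_smul,
      Ideal.Quotient.mkₐ_eq_mk, Ideal.Quotient.eq, smul_eq_C_mul, mul_one]
    exact exists_sub_C_mem_idealOfVars p
  obtain ⟨s, hs⟩ := hsoc f hf
  obtain ⟨t, ht⟩ := hsoc g hg
  obtain ⟨a, ha⟩ := hconst (ε s)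
  obtain ⟨b, hb⟩ := hconst (ε t)
  have ha0 : a ≠ 0 := by
    rintro rfl
    rw [zero_smul, ← map_zero ε] at ha
    rw [hε ha] at hs
    exact hf0 (Ideal.Quotient.eq_zero_iff_mem.mp hs.symm)
  have hab : t = (b / a) • s := by
    apply hε
    rw [map_rat_smul ε, ha, hb, smul_smul, div_mul_cancel₀ _ ha0]
  refine ⟨b / a, ?_⟩
  rw [← Ideal.Quotient.eq, ← ht, hab, LinearMap.smul_apply, hs, ← MvPolynomial.smul_eq_C_mul,
    ← Ideal.Quotient.mkₐ_eq_mk ℚ, map_smul]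

end Socle

/-! ### Krull's height theorem at the origin -/

section Krull

variable {k : ℕ}

/-- The ideal of the polynomials that vanish when the first `j` variables are set to zero. -/
noncomputable def killFirst (k j : ℕ) : MvPolynomial (Fin k) ℚ →ₐ[ℚ] MvPolynomial (Fin k) ℚ :=
  aeval fun i => if i.val < j then 0 else X i

theorem le_height_ker_killFirst {j : ℕ} (hj : j ≤ k) :
    (j : ℕ∞) ≤ (RingHom.ker (killFirst k j)).height := by
  induction j with
  | zero => simp
  | succ j ih =>
    have hprime : ∀ j, (RingHom.ker (killFirst k j)).IsPrime := fun j => RingHom.ker_isPrime _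
    have hlt : RingHom.ker (killFirst k j) < RingHom.ker (killFirst k (j + 1)) := by
      refine lt_of_le_of_ne (fun f hf => ?_) fun h => ?_
      · have hcomp : (killFirst k (j + 1)).comp (killFirst k j) = killFirst k (j + 1) := by
          ext i : 1
          simp only [killFirst, AlgHom.comp_apply, aeval_X]
          split_ifs with h1 h2
          · simp
          · omega
          · rw [aeval_X, if_pos ‹_›]
          · rw [aeval_X, if_neg ‹_›]
        rw [RingHom.mem_ker] at hf ⊢
        rw [← hcomp, AlgHom.comp_apply, hf, map_zero]
      · have hmem : (X ⟨j, hj⟩ : MvPolynomial (Fin k) ℚ) ∈ RingHom.ker (killFirst k (j + 1)) := by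
          simp [RingHom.mem_ker, killFirst]
        rw [← h, RingHom.mem_ker] at hmem
        simp [killFirst] at hmem
    have := hprime j
    have := hprime (j + 1)
    calc ((j + 1 : ℕ) : ℕ∞) = j + 1 := by push_cast; rfl
      _ ≤ (RingHom.ker (killFirst k j)).height + 1 := by gcongr; exact ih (by omega)
      _ ≤ _ := Ideal.height_add_one_le_of_lt_of_isPrime hlt

/-- **Krull's height theorem** for the homogeneous maximal ideal of a polynomial ring. -/
theorem le_finrank_of_pow_mem_span {V : Submodule ℚ (MvPolynomial (Fin k) ℚ)}
    [Module.Finite ℚ V] (hV : (V : Set (MvPolynomial (Fin k) ℚ)) ⊆ idealOfVars (Fin k) ℚ)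
    (hnil : ∀ i, ∃ n, (X i : MvPolynomial (Fin k) ℚ) ^ n ∈
      Ideal.span (V : Set (MvPolynomial (Fin k) ℚ))) :
    k ≤ Module.finrank ℚ V := by
  classical
  have hker : RingHom.ker (killFirst k k) = idealOfVars (Fin k) ℚ := by
    ext f
    have h0 : killFirst k k f = C (coeff 0 f) := by
      have : (fun i : Fin k => if i.val < k then (0 : MvPolynomial (Fin k) ℚ) else X i) =
          fun _ => 0 := by
        funext i
        rw [if_pos i.isLt]
      rw [killFirst, this, aeval_zero', algebraMap_eq, constantCoeff_eq]
    rw [RingHom.mem_ker, h0, C_eq_zero]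
    constructor
    · intro h
      simpa [h] using exists_sub_C_mem_idealOfVars f
    · intro h
      rw [← pow_one (idealOfVars (Fin k) ℚ), mem_pow_idealOfVars_iff'] at h
      exact h 0 (by simp)
  have hprime : (idealOfVars (Fin k) ℚ).IsPrime := hker ▸ RingHom.ker_isPrime _
  let b := Module.finBasis ℚ V
  let s : Finset (MvPolynomial (Fin k) ℚ) := Finset.univ.image fun i => (b i : MvPolynomial _ ℚ)
  have hspan : Ideal.span (s : Set (MvPolynomial (Fin k) ℚ)) =
      Ideal.span (V : Set (MvPolynomial (Fin k) ℚ)) := by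
    have h1 : (V : Set (MvPolynomial (Fin k) ℚ)) =
        Submodule.span ℚ (s : Set (MvPolynomial (Fin k) ℚ)) := by
      have h2 : (s : Set (MvPolynomial (Fin k) ℚ)) = V.subtype '' Set.range b := by
        ext x
        simp [s]
      rw [h2, Submodule.span_image, b.span_eq, Submodule.map_top, Submodule.range_subtype]
    rw [h1]
    exact (Submodule.span_span_of_tower ℚ (MvPolynomial (Fin k) ℚ) _).symm
  -- A prime over the ideal contains a power of each variable, hence each variable.
  have hmin : idealOfVars (Fin k) ℚ ∈
      (Ideal.span (s : Set (MvPolynomial (Fin k) ℚ))).minimalPrimes := by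
    rw [hspan]
    refine ⟨⟨hprime, Ideal.span_le.mpr hV⟩, fun q hq _ => ?_⟩
    rw [idealOfVars, Ideal.span_le]
    rintro _ ⟨i, rfl⟩
    obtain ⟨n, hn⟩ := hnil i
    exact hq.1.mem_of_pow_mem n (hq.2 hn)
  have h1 := Ideal.height_le_card_of_mem_minimalPrimes_span_finset hmin
  have h2 := hker ▸ le_height_ker_killFirst (le_refl k)
  have h3 : k ≤ s.card := by exact_mod_cast h2.trans h1
  refine h3.trans (Finset.card_image_le.trans ?_)
  simp

end Krull

/-! ### Derivations of polynomial rings -/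

section Derivations

variable {k : ℕ}

theorem derivation_apply_eq_sum_pderiv
    (D : Derivation ℚ (MvPolynomial (Fin k) ℚ) (MvPolynomial (Fin k) ℚ))
    (f : MvPolynomial (Fin k) ℚ) : D f = ∑ j, pderiv j f * D (X j) := by
  classical
  have hsum : ∀ g, (∑ j, D (X j) • pderiv j :
      Derivation ℚ (MvPolynomial (Fin k) ℚ) (MvPolynomial (Fin k) ℚ)) g =
      ∑ j, pderiv j g * D (X j) := fun g => by
    have := congrFun (map_sum (Derivation.coeFnAddMonoidHom (R := ℚ) (A := MvPolynomial (Fin k) ℚ)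
      (M := MvPolynomial (Fin k) ℚ)) (fun j => D (X j) • pderiv j) Finset.univ) g
    rw [Finset.sum_apply] at this
    exact this.trans (Finset.sum_congr rfl fun j _ => mul_comm _ _)
  have h : D = ∑ j, D (X j) • pderiv j := derivation_ext fun i => by
    rw [hsum, Finset.sum_eq_single i]
    · simp
    · intro j _ hj
      simp [pderiv_X_of_ne hj.symm]
    · simp
  conv_lhs => rw [h]
  exact hsum f

/-- A derivation of a polynomial ring that lowers the degrees of the variables by `e` lowers
all degrees by `e`. -/
theorem weightedHomogeneousComponent_derivation {w : Fin k → ℕ} {e : ℕ}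
    {D : Derivation ℚ (MvPolynomial (Fin k) ℚ) (MvPolynomial (Fin k) ℚ)}
    (hD : ∀ j n, w j = n + e → IsWeightedHomogeneous w (D (X j)) n)
    (hD0 : ∀ j, w j < e → D (X j) = 0) (f : MvPolynomial (Fin k) ℚ) (m : ℕ) :
    weightedHomogeneousComponent w m (D f) = D (weightedHomogeneousComponent w (m + e) f) := by
  classical
  induction f using MvPolynomial.induction_on' with
  | add p q hp hq => simp only [map_add, hp, hq]
  | monomial a c =>
    set n := Finsupp.weight w a with hn
    have hterm : ∀ j, weightedHomogeneousComponent w m (pderiv j (monomial a c) * D (X j)) =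
        if m + e = n then pderiv j (monomial a c) * D (X j) else 0 := by
      intro j
      by_cases ha : a j = 0
      · simp [pderiv_monomial, ha]
      obtain he | he := lt_or_ge (w j) e
      · simp [hD0 j he]
      obtain ⟨l, hl⟩ := Nat.exists_eq_add_of_le' he
      have hw : Finsupp.weight w (a - Finsupp.single j 1) + w j = n := by
        rw [Finsupp.weight_sub_single_add ha]
      have h1 : IsWeightedHomogeneous w (pderiv j (monomial a c))
          (Finsupp.weight w (a - Finsupp.single j 1)) := by
        rw [pderiv_monomial]
        exact isWeightedHomogeneous_monomial _ _ _ rfl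
      rw [weightedHomogeneousComponent_of_mem
        ((mem_weightedHomogeneousSubmodule ℚ w _ _).mpr (h1.mul (hD j l hl)))]
      congr 1
      rw [eq_iff_iff]
      omega
    have hf : weightedHomogeneousComponent w (m + e) (monomial a c) =
        if m + e = n then monomial a c else 0 :=
      weightedHomogeneousComponent_of_mem
        ((mem_weightedHomogeneousSubmodule ℚ w _ _).mpr (isWeightedHomogeneous_monomial w a c rfl))
    rw [hf, derivation_apply_eq_sum_pderiv D (monomial a c), map_sum]
    simp_rw [hterm]
    split_ifs
    · rw [← derivation_apply_eq_sum_pderiv]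
    · simp

/-- A non-zero derivation with constant coefficients is surjective. -/
theorem exists_sum_C_mul_pderiv_eq {c : Fin k → ℚ} {i : Fin k} (hc : c i ≠ 0)
    (f : MvPolynomial (Fin k) ℚ) : ∃ g, ∑ j, C (c j) * pderiv j g = f := by
  classical
  let E : Derivation ℚ (MvPolynomial (Fin k) ℚ) (MvPolynomial (Fin k) ℚ) :=
    mkDerivation ℚ fun j => C (c j)
  have hE : ∀ g, ∑ j, C (c j) * pderiv j g = E g := fun g => by
    rw [derivation_apply_eq_sum_pderiv E g]
    exact Finset.sum_congr rfl fun j _ => by rw [mkDerivation_X, mul_comm]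
  simp_rw [hE]
  let y : MvPolynomial (Fin k) ℚ := C (c i)⁻¹ * X i
  have hy : E y = 1 := by
    change E (C (c i)⁻¹ * X i) = 1
    rw [C_mul', Derivation.map_smul, mkDerivation_X, ← C_mul', ← C_mul, inv_mul_cancel₀ hc, C_1]
  -- Integration by parts: E(y^(m+1) f)/(m+1) = y^m f + y^(m+1) E(f)/(m+1), and E(f) has smaller
  -- degree. The induction needs every `m`.
  have key : ∀ n (f : MvPolynomial (Fin k) ℚ), f.IsHomogeneous n → ∀ m, ∃ g, E g = y ^ m * f := by
    intro n
    induction n with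
    | zero =>
      intro f hf m
      rw [← totalDegree_zero_iff_isHomogeneous, totalDegree_eq_zero_iff_eq_C] at hf
      refine ⟨C ((m + 1 : ℚ)⁻¹) * (y ^ (m + 1) * f), ?_⟩
      have hm : (m + 1 : ℚ) ≠ 0 := by positivity
      have hEf : E f = 0 := by rw [hf, derivation_C]
      rw [C_mul', Derivation.map_smul, Derivation.leibniz, hEf, Derivation.leibniz_pow, hy]
      simp only [smul_eq_mul, mul_zero, zero_add, nsmul_eq_mul, Nat.add_sub_cancel, mul_one]
      rw [← C_mul', show ((m + 1 : ℕ) : MvPolynomial (Fin k) ℚ) = C (m + 1 : ℚ) by simp,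
        mul_left_comm f, ← mul_assoc, ← C_mul, inv_mul_cancel₀ hm, C_1]
      ring
    | succ n ih =>
      intro f hf m
      have hEf : (E f).IsHomogeneous n := by
        rw [← hE]
        refine IsHomogeneous.sum _ _ _ fun j _ => ?_
        simpa using (isHomogeneous_C (Fin k) (c j)).mul hf.pderiv
      obtain ⟨g, hg⟩ := ih _ hEf (m + 1)
      refine ⟨C ((m + 1 : ℚ)⁻¹) * (y ^ (m + 1) * f - g), ?_⟩
      have hm : (m + 1 : ℚ) ≠ 0 := by positivity
      rw [C_mul', Derivation.map_smul, map_sub, Derivation.leibniz, Derivation.leibniz_pow, hy, hg]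
      simp only [smul_eq_mul, nsmul_eq_mul, Nat.add_sub_cancel, mul_one]
      rw [add_sub_cancel_left, ← C_mul',
        show ((m + 1 : ℕ) : MvPolynomial (Fin k) ℚ) = C (m + 1 : ℚ) by simp,
        mul_left_comm f, ← mul_assoc, ← C_mul, inv_mul_cancel₀ hm, C_1]
      ring
  choose g hg using fun n => key n _ (homogeneousComponent_isHomogeneous n f) 0
  refine ⟨∑ n ∈ Finset.range (f.totalDegree + 1), g n, ?_⟩
  rw [map_sum]
  simp_rw [hg, pow_zero, one_mul]
  exact sum_homogeneousComponent f

end Derivations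

/-! ### Top degree, socle and the obstruction to derivations -/

namespace PositivelyElliptic

/-- The ideal of relations. -/
noncomputable abbrev relIdeal (P : PositivelyElliptic) : Ideal (MvPolynomial (Fin P.k) ℚ) :=
  Ideal.span (Set.range P.rel)

variable {P : PositivelyElliptic}

theorem one_notMem_relIdeal : (1 : MvPolynomial (Fin P.k) ℚ) ∉ P.relIdeal := fun h => by
  refine P.rel_regular.top_ne_smul ?_
  rw [ofList_ofFn, smul_eq_mul, Ideal.mul_top]
  exact ((Ideal.eq_top_iff_one _).mpr h).symm

theorem rel_ne_zero (i : Fin P.k) : P.rel i ≠ 0 := by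
  intro h0
  have h := P.rel_regular.regular_mod_prev i.val (by simp)
  rw [isSMulRegular_quotient_iff_mem_of_smul_mem] at h
  have h1 := h 1 (by simp [h0])
  refine one_notMem_relIdeal (P := P) ?_
  rw [smul_eq_mul, Ideal.mul_top] at h1
  refine Ideal.span_mono ?_ h1
  intro x hx
  obtain ⟨j, hj⟩ := (List.mem_ofFn' _ _).mp (List.mem_of_mem_take hx)
  exact ⟨j, hj⟩

theorem rel_mem_idealOfVars_sq (hP : P.IsPureModel) (i : Fin P.k) :
    P.rel i ∈ idealOfVars (Fin P.k) ℚ ^ 2 :=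
  (mem_pow_idealOfVars_iff 2 _).mpr (hP.two_le i)

theorem relIdeal_le (hP : P.IsPureModel) : P.relIdeal ≤ idealOfVars (Fin P.k) ℚ ^ 2 := by
  rw [Ideal.span_le]
  rintro _ ⟨i, rfl⟩
  exact rel_mem_idealOfVars_sq hP i

theorem rel_mem_idealOfVars (hP : P.IsPureModel) (i : Fin P.k) :
    P.rel i ∈ idealOfVars (Fin P.k) ℚ :=
  Ideal.pow_le_self two_ne_zero (rel_mem_idealOfVars_sq hP i)

theorem degree_le_weight {w : Fin P.k → ℕ} (hw : ∀ i, 0 < w i) (a : Fin P.k →₀ ℕ) :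
    a.degree ≤ Finsupp.weight w a := by
  rw [Finsupp.degree_eq_sum, Finsupp.weight_apply, Finsupp.sum_fintype _ _ (by simp)]
  exact Finset.sum_le_sum fun i _ => by
    rw [smul_eq_mul]
    exact Nat.le_mul_of_pos_right _ (hw i)

theorem relDeg_pos (hP : P.IsPureModel) (i : Fin P.k) : 0 < P.relDeg i := by
  obtain ⟨a, ha⟩ := support_nonempty.mpr (rel_ne_zero i)
  rw [← P.rel_homogeneous i (mem_support_iff.mp ha)]
  have := hP.two_le i a ha
  have := degree_le_weight P.deg_pos a
  omega

theorem isGradedIdeal_relIdeal (P : PositivelyElliptic) : IsGradedIdeal P.deg P.relIdeal :=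
  (hilbertSeries_span_range P.deg_pos P.rel_homogeneous P.rel_regular.toIsWeaklyRegular).1

/-- The top degree of `H`, as seen on polynomials. -/
theorem exists_top (hP : P.IsPureModel) :
    ∃ N, N + ∑ i, P.deg i = ∑ i, P.relDeg i ∧ N ≤ P.formalDimension ∧
      (∀ n f, N < n → IsWeightedHomogeneous P.deg f n → f ∈ P.relIdeal) ∧
      ∃ τ, IsWeightedHomogeneous P.deg τ N ∧ τ ∉ P.relIdeal := by
  obtain ⟨N, hN, hbot, htop⟩ := quotientPiece_top P.deg_pos (relDeg_pos hP) P.rel_homogeneous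
    P.rel_regular.toIsWeaklyRegular
  have hne : P.piece N ≠ ⊥ := fun h => by
    change quotientPiece P.deg P.relIdeal N = ⊥ at h
    rw [h, finrank_bot] at htop
    exact zero_ne_one htop
  refine ⟨N, hN, le_csSup ⟨N, fun n hn => ?_⟩ hne, fun n f hn hf => ?_, ?_⟩
  · by_contra hlt
    exact hn (hbot n (not_le.mp hlt))
  · have h : Ideal.Quotient.mk P.relIdeal f ∈ quotientPiece P.deg P.relIdeal n :=
      mem_quotientPiece.mpr ⟨f, hf, rfl⟩
    rw [hbot n hn] at h
    exact Ideal.Quotient.eq_zero_iff_mem.mp ((Submodule.mem_bot ℚ).mp h)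
  · obtain ⟨x, hx, hx0⟩ := (Submodule.ne_bot_iff _).mp hne
    obtain ⟨f, hf, rfl⟩ := mem_quotientPiece.mp hx
    exact ⟨f, hf, fun h => hx0 (Ideal.Quotient.eq_zero_iff_mem.mpr h)⟩

theorem pow_idealOfVars_le (hP : P.IsPureModel) :
    ∃ n, idealOfVars (Fin P.k) ℚ ^ n ≤ P.relIdeal := by
  obtain ⟨N, -, -, hN, -⟩ := exists_top hP
  refine ⟨N + 1, ?_⟩
  rw [pow_idealOfVars_eq_span, Ideal.span_le]
  rintro _ ⟨a, ha, rfl⟩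
  refine hN (Finsupp.weight P.deg a) _ ?_ (isWeightedHomogeneous_monomial _ _ _ rfl)
  have := degree_le_weight P.deg_pos a
  have : a.degree = N + 1 := ha
  omega

theorem exists_X_pow_mem (hP : P.IsPureModel) :
    ∃ n, ∀ i, (X i : MvPolynomial (Fin P.k) ℚ) ^ n ∈ P.relIdeal := by
  obtain ⟨n, hn⟩ := pow_idealOfVars_le hP
  exact ⟨n, fun i => hn (Ideal.pow_mem_pow (Ideal.subset_span (Set.mem_range_self i)) n)⟩

/-- Every element outside the ideal of relations has a multiple that spans the socle. -/
theorem exists_mul_mem_socle (hP : P.IsPureModel) {σ : MvPolynomial (Fin P.k) ℚ}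
    (hσ : σ ∉ P.relIdeal) : ∃ s, s * σ ∉ P.relIdeal ∧ ∀ i, X i * (s * σ) ∈ P.relIdeal := by
  classical
  obtain ⟨n, hn⟩ := pow_idealOfVars_le hP
  -- The multiplier is found in the last power of the maximal ideal that does not kill `σ` modulo
  -- the relations.
  have hex : ∃ n, ∀ s ∈ idealOfVars (Fin P.k) ℚ ^ n, s * σ ∈ P.relIdeal :=
    ⟨n, fun s hs => Ideal.mul_mem_right _ _ (hn hs)⟩
  have hpos : Nat.find hex ≠ 0 := fun h0 => by
    have := Nat.find_spec hex
    rw [h0] at this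
    exact hσ (by simpa using this 1 (by simp))
  obtain ⟨m, hm⟩ := Nat.exists_eq_succ_of_ne_zero hpos
  have hmin := Nat.find_min hex (m := m) (by omega)
  push Not at hmin
  obtain ⟨s, hs, hsσ⟩ := hmin
  refine ⟨s, hsσ, fun i => ?_⟩
  have hspec := Nat.find_spec hex
  rw [hm] at hspec
  rw [← mul_assoc]
  refine hspec _ ?_
  rw [Nat.succ_eq_add_one, pow_succ']
  exact Ideal.mul_mem_mul (Ideal.subset_span (Set.mem_range_self i)) hs

/-- A derivation of negative degree cannot have a non-zero ideal in its image: by Poincaré duality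
such an ideal contains the top degree. -/
theorem false_of_mul_derivation_X_sub_mem (hP : P.IsPureModel) {e : ℕ} (he : 0 < e)
    {D : Derivation ℚ (MvPolynomial (Fin P.k) ℚ) (MvPolynomial (Fin P.k) ℚ)}
    (hD : ∀ j n, P.deg j = n + e → IsWeightedHomogeneous P.deg (D (X j)) n)
    (hD0 : ∀ j, P.deg j < e → D (X j) = 0) (hDI : ∀ f ∈ P.relIdeal, D f ∈ P.relIdeal)
    {b σ : MvPolynomial (Fin P.k) ℚ} (hb : D b = 0) (hσ : σ ∉ P.relIdeal) {c : Fin P.k → ℚ}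
    (hc : ∀ j, b * D (X j) - C (c j) * σ ∈ P.relIdeal) {i : Fin P.k} (hci : c i ≠ 0) : False := by
  obtain ⟨N, -, -, hN, τ, hτ, hτI⟩ := exists_top hP
  obtain ⟨s, hs, hsoc⟩ := exists_mul_mem_socle hP hσ
  obtain ⟨a, ha⟩ := exists_sub_C_mul_mem_of_socle P.rel_regular (rel_mem_idealOfVars hP) hsoc
    (fun i => hN (P.deg i + N) (X i * τ) (by have := P.deg_pos i; omega)
      ((isWeightedHomogeneous_X ℚ P.deg i).mul hτ)) hs
  -- Since `D b = 0` and `b * D (X j)` is `c j` times `σ` modulo the relations, this `g` makes `D (b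
  -- * g)` congruent to `a s σ`, that is, to the top class `τ`.
  obtain ⟨g, hg⟩ := exists_sum_C_mul_pderiv_eq hci (C a * s)
  have h1 : D (b * g) - σ * (C a * s) ∈ P.relIdeal := by
    rw [Derivation.leibniz, hb, smul_zero, add_zero, derivation_apply_eq_sum_pderiv D g, ← hg,
      smul_eq_mul, Finset.mul_sum, Finset.mul_sum, ← Finset.sum_sub_distrib]
    refine Ideal.sum_mem _ fun j _ => ?_
    have := Ideal.mul_mem_left _ (pderiv j g) (hc j)
    convert this using 1
    ring
  have h2 : τ - D (b * g) ∈ P.relIdeal := by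
    convert Ideal.sub_mem _ ha h1 using 1
    ring
  have h3 := isGradedIdeal_relIdeal P _ h2 N
  rw [map_sub, hτ.weightedHomogeneousComponent_same, weightedHomogeneousComponent_derivation hD hD0]
    at h3
  -- Degree `N + e` is above the top degree, so this component lies in the ideal, and so does its
  -- image, which is congruent to `τ`.
  have h4 := hDI _ (hN (N + e) _ (by omega)
    (weightedHomogeneousComponent_isWeightedHomogeneous (w := P.deg) (N + e) (b * g)))
  exact hτI (by simpa using Ideal.add_mem _ h3 h4)

end PositivelyElliptic

/-! ### Lifting derivations of negative degree -/

namespace PositivelyElliptic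

variable {P : PositivelyElliptic}

theorem even_weight (a : Fin P.k →₀ ℕ) : Even (Finsupp.weight P.deg a) := by
  rw [Finsupp.weight_apply, Finsupp.sum_fintype _ _ (by simp)]
  exact Finset.even_sum _ fun i _ => by
    rw [smul_eq_mul]
    exact (P.deg_even i).mul_left _

theorem even_of_isWeightedHomogeneous {f : MvPolynomial (Fin P.k) ℚ} {n : ℕ}
    (hf : IsWeightedHomogeneous P.deg f n) (h0 : f ≠ 0) : Even n := by
  obtain ⟨a, ha⟩ := support_nonempty.mpr h0
  rw [← hf (mem_support_iff.mp ha)]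
  exact even_weight a

theorem eq_C_of_isWeightedHomogeneous_zero {f : MvPolynomial (Fin P.k) ℚ}
    (hf : IsWeightedHomogeneous P.deg f 0) : f = C (coeff 0 f) := by
  ext a
  rw [coeff_C]
  split_ifs with h
  · rw [h]
  · by_contra hne
    have h1 := degree_le_weight P.deg_pos a
    rw [hf hne] at h1
    exact h ((Finsupp.degree_eq_zero_iff a).mp (by omega)).symm

/-- A derivation that preserves the ideal of relations cannot map a variable to a non-zero
constant. -/
theorem eq_zero_of_derivation_X_eq_C (hP : P.IsPureModel)
    {D : Derivation ℚ (MvPolynomial (Fin P.k) ℚ) (MvPolynomial (Fin P.k) ℚ)}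
    (hDI : ∀ f ∈ P.relIdeal, D f ∈ P.relIdeal) {j : Fin P.k} {c : ℚ} (hj : D (X j) = C c) :
    c = 0 := by
  classical
  by_contra hc
  -- Applied to the least power of `X j` in the ideal, `D` gives a non-zero multiple of the
  -- preceding power.
  have hex : ∃ n, (X j : MvPolynomial (Fin P.k) ℚ) ^ n ∈ P.relIdeal := by
    obtain ⟨n, hn⟩ := exists_X_pow_mem hP
    exact ⟨n, hn j⟩
  have hspec := Nat.find_spec hex
  obtain h0 | ⟨m, hm⟩ : Nat.find hex = 0 ∨ ∃ m, Nat.find hex = m + 1 := by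
    cases h : Nat.find hex <;> simp
  · rw [h0, pow_zero] at hspec
    exact one_notMem_relIdeal hspec
  · rw [hm] at hspec
    have h1 := hDI _ hspec
    rw [Derivation.leibniz_pow, hj, Nat.add_sub_cancel, smul_eq_mul, nsmul_eq_mul] at h1
    have hm0 : ((m : ℚ) + 1) * c ≠ 0 := mul_ne_zero (by positivity) hc
    refine Nat.find_min hex (m := m) (by omega) ?_
    have h2 := Ideal.mul_mem_left _ (C (((m : ℚ) + 1) * c)⁻¹) h1
    convert h2 using 1
    rw [show ((m + 1 : ℕ) : MvPolynomial (Fin P.k) ℚ) = C ((m : ℚ) + 1) by simp, mul_left_comm,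
      mul_comm (X j ^ m), ← mul_assoc (C ((m : ℚ) + 1)), ← C_mul, ← mul_assoc, ← C_mul,
      mul_right_comm, mul_inv_cancel₀ hm0, C_1, one_mul]

/-- A non-zero derivation of `H` of negative degree lifts to the polynomial ring. -/
theorem HasNegativeDerivation.exists_lift (hP : P.IsPureModel) (h : P.HasNegativeDerivation) :
    ∃ (D : Derivation ℚ (MvPolynomial (Fin P.k) ℚ) (MvPolynomial (Fin P.k) ℚ)) (e : ℕ),
      2 ≤ e ∧ (∀ j n, P.deg j = n + e → IsWeightedHomogeneous P.deg (D (X j)) n) ∧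
      (∀ j, P.deg j ≤ e → D (X j) = 0) ∧ (∀ f ∈ P.relIdeal, D f ∈ P.relIdeal) ∧
      ∃ j, D (X j) ∉ P.relIdeal := by
  obtain ⟨δ, e', he', hδ, hδ0⟩ := h
  obtain ⟨e, rfl⟩ : ∃ e : ℕ, e' = -(e : ℤ) := ⟨e'.natAbs, by omega⟩
  have hlift : ∀ j, ∃ θ, Ideal.Quotient.mk P.relIdeal θ = δ (Ideal.Quotient.mk _ (X j)) ∧
      (∀ n, P.deg j = n + e → IsWeightedHomogeneous P.deg θ n) ∧ (P.deg j < e → θ = 0) := by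
    intro j
    have hX : Ideal.Quotient.mk P.relIdeal (X j) ∈ P.pieceInt (P.deg j : ℤ) :=
      mem_quotientPiece.mpr ⟨X j, isWeightedHomogeneous_X ℚ P.deg j, rfl⟩
    have h1 := hδ _ _ hX
    obtain hlt | hge := lt_or_ge (P.deg j) e
    · obtain ⟨m, hm⟩ : ∃ m : ℕ, (P.deg j : ℤ) + -(e : ℤ) = Int.negSucc m :=
        ⟨e - P.deg j - 1, by omega⟩
      rw [hm] at h1
      exact ⟨0, by rw [map_zero]; exact ((Submodule.mem_bot ℚ).mp h1).symm,
        fun n hn => by omega, fun _ => rfl⟩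
    · obtain ⟨n, hn⟩ := Nat.exists_eq_add_of_le' hge
      have hn' : (P.deg j : ℤ) + -(e : ℤ) = Int.ofNat n := by
        rw [hn]; push_cast; simp
      rw [hn'] at h1
      obtain ⟨θ, hθ, hθ'⟩ := mem_quotientPiece.mp h1
      refine ⟨θ, hθ', fun m hm => ?_, fun _ => by omega⟩
      obtain rfl : m = n := by omega
      exact hθ
  choose θ hθδ hθ hθ0 using hlift
  let D : Derivation ℚ (MvPolynomial (Fin P.k) ℚ) (MvPolynomial (Fin P.k) ℚ) := mkDerivation ℚ θ
  have hDX : ∀ j, D (X j) = θ j := fun j => mkDerivation_X ℚ θ j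
  have hDδ : ∀ f, Ideal.Quotient.mk P.relIdeal (D f) = δ (Ideal.Quotient.mk _ f) := by
    intro f
    induction f using MvPolynomial.induction_on with
    | C a =>
      rw [derivation_C, map_zero]
      exact (δ.map_algebraMap a).symm
    | add p q hp hq => rw [map_add, map_add, hp, hq, map_add, map_add]
    | mul_X p i hp =>
      rw [Derivation.leibniz, map_mul, Derivation.leibniz, hDX]
      simp only [smul_eq_mul, map_add, map_mul, hp, hθδ]
  have hDI : ∀ f ∈ P.relIdeal, D f ∈ P.relIdeal := fun f hf => by
    rw [← Ideal.Quotient.eq_zero_iff_mem, hDδ, Ideal.Quotient.eq_zero_iff_mem.mpr hf, map_zero]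
  have hne : ∃ j, D (X j) ∉ P.relIdeal := by
    by_contra! hall
    refine hδ0 (Derivation.ext fun x => ?_)
    obtain ⟨f, rfl⟩ := Ideal.Quotient.mk_surjective x
    rw [← hDδ, Derivation.zero_apply, Ideal.Quotient.eq_zero_iff_mem,
      derivation_apply_eq_sum_pderiv]
    exact Ideal.sum_mem _ fun j _ => Ideal.mul_mem_left _ _ (hall j)
  have hzero : ∀ j, P.deg j ≤ e → D (X j) = 0 := by
    intro j hj
    obtain hlt | heq := lt_or_eq_of_le hj
    · rw [hDX, hθ0 j hlt]
    · have h1 := hθ j 0 (by omega)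
      have h2 := eq_C_of_isWeightedHomogeneous_zero h1
      rw [hDX, h2, eq_zero_of_derivation_X_eq_C hP hDI ((hDX j).trans h2), C_0]
  refine ⟨D, e, ?_, fun j n hn => by rw [hDX]; exact hθ j n hn, hzero, hDI, hne⟩
  obtain ⟨j, hj⟩ := hne
  have hj0 : D (X j) ≠ 0 := fun h => hj (h ▸ Ideal.zero_mem _)
  have hlt : e < P.deg j := by
    by_contra hle
    exact hj0 (hzero j (not_lt.mp hle))
  obtain ⟨n, hn⟩ := Nat.exists_eq_add_of_le' hlt.le
  have h1 := even_of_isWeightedHomogeneous (hθ j n hn) (hDX j ▸ hj0)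
  have h2 := P.deg_even j
  rw [hn] at h2
  have := (Nat.even_add.mp h2).mp h1
  obtain ⟨c, hc⟩ := this
  omega

/-- A derivation of negative degree that is non-zero moves at least two variables. -/
theorem false_of_derivation_X_eq_zero (hP : P.IsPureModel) {e : ℕ} (he : 0 < e)
    {D : Derivation ℚ (MvPolynomial (Fin P.k) ℚ) (MvPolynomial (Fin P.k) ℚ)}
    (hD : ∀ j n, P.deg j = n + e → IsWeightedHomogeneous P.deg (D (X j)) n)
    (hD0 : ∀ j, P.deg j ≤ e → D (X j) = 0) (hDI : ∀ f ∈ P.relIdeal, D f ∈ P.relIdeal)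
    {i j : Fin P.k} (hi : ∀ l, l ≠ i → D (X l) = 0) (hj : D (X j) ∉ P.relIdeal) : False := by
  classical
  obtain rfl : j = i := by
    by_contra hne
    rw [hi j hne] at hj
    exact hj (Ideal.zero_mem _)
  refine false_of_mul_derivation_X_sub_mem hP he hD (fun l hl => hD0 l hl.le) hDI (b := 1)
    (by simp) hj (c := Pi.single j 1) (fun l => ?_) (i := j) (by simp)
  by_cases hl : l = j
  · simp [hl]
  · simp [hi l hl, hl]

end PositivelyElliptic

/-! ### Relations of a given degree -/

namespace PositivelyElliptic

variable {P : PositivelyElliptic}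

/-- The span of the relations whose degree satisfies `p`. -/
noncomputable def relSpan (P : PositivelyElliptic) (p : ℕ → Prop) :
    Submodule ℚ (MvPolynomial (Fin P.k) ℚ) :=
  Submodule.span ℚ (Set.range fun i : {i // p (P.relDeg i)} => P.rel i)

instance (p : ℕ → Prop) : Module.Finite ℚ (P.relSpan p) :=
  Module.Finite.span_of_finite ℚ (Set.finite_range _)

theorem rel_mem_relSpan {p : ℕ → Prop} {i : Fin P.k} (h : p (P.relDeg i)) :
    P.rel i ∈ P.relSpan p :=
  Submodule.subset_span ⟨⟨i, h⟩, rfl⟩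

theorem relSpan_le_restrictScalars (p : ℕ → Prop) :
    P.relSpan p ≤ P.relIdeal.restrictScalars ℚ := by
  refine Submodule.span_le.mpr ?_
  rintro _ ⟨i, rfl⟩
  exact Ideal.subset_span ⟨i, rfl⟩

theorem isWeightedHomogeneous_of_mem_relSpan {n : ℕ} {f : MvPolynomial (Fin P.k) ℚ}
    (hf : f ∈ P.relSpan (· = n)) : IsWeightedHomogeneous P.deg f n := by
  have : P.relSpan (· = n) ≤ weightedHomogeneousSubmodule ℚ P.deg n := by
    refine Submodule.span_le.mpr ?_
    rintro _ ⟨⟨i, rfl⟩, rfl⟩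
    exact P.rel_homogeneous i
  exact this hf

/-- **Krull's height theorem**: a space of polynomials without constant term that generates an
ideal containing all the relations has dimension at least `k`. -/
theorem le_finrank_of_rel_mem (hP : P.IsPureModel) (V : Submodule ℚ (MvPolynomial (Fin P.k) ℚ))
    [Module.Finite ℚ V] (hV : ∀ f ∈ V, f ∈ idealOfVars (Fin P.k) ℚ)
    (h : ∀ i, P.rel i ∈ Ideal.span (V : Set (MvPolynomial (Fin P.k) ℚ))) :
    P.k ≤ Module.finrank ℚ V := by
  refine le_finrank_of_pow_mem_span hV fun i => ?_
  obtain ⟨n, hn⟩ := exists_X_pow_mem hP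
  refine ⟨n, (Ideal.span_le.mpr ?_ : P.relIdeal ≤ _) (hn i)⟩
  rintro _ ⟨j, rfl⟩
  exact h j

/-- By Krull, the relations cannot span a space of dimension below `k`. -/
theorem linearIndependent_rel (hP : P.IsPureModel) : LinearIndependent ℚ P.rel := by
  rw [linearIndependent_iff_card_le_finrank_span, Fintype.card_fin]
  have : Module.Finite ℚ (Submodule.span ℚ (Set.range P.rel)) :=
    Module.Finite.span_of_finite ℚ (Set.finite_range _)
  refine le_finrank_of_rel_mem hP _ (fun f hf => ?_) fun i =>
    Ideal.subset_span (Submodule.subset_span ⟨i, rfl⟩)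
  have hle : Submodule.span ℚ (Set.range P.rel) ≤
      (idealOfVars (Fin P.k) ℚ).restrictScalars ℚ := by
    refine Submodule.span_le.mpr ?_
    rintro _ ⟨i, rfl⟩
    exact rel_mem_idealOfVars hP i
  exact hle hf

theorem finrank_relSpan (hP : P.IsPureModel) (p : ℕ → Prop) [DecidablePred p] :
    Module.finrank ℚ (P.relSpan p) = (Finset.univ.filter fun i => p (P.relDeg i)).card := by
  have h : LinearIndependent ℚ fun i : {i // p (P.relDeg i)} => P.rel i :=
    (linearIndependent_rel hP).comp _ Subtype.val_injective
  rw [relSpan, finrank_span_eq_card h, Fintype.card_subtype]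

theorem relSpan_le_idealOfVars (hP : P.IsPureModel) {p : ℕ → Prop}
    {f : MvPolynomial (Fin P.k) ℚ} (hf : f ∈ P.relSpan p) : f ∈ idealOfVars (Fin P.k) ℚ :=
  Ideal.pow_le_self two_ne_zero (relIdeal_le hP (relSpan_le_restrictScalars p hf))

theorem even_relDeg (i : Fin P.k) : Even (P.relDeg i) :=
  even_of_isWeightedHomogeneous (P.rel_homogeneous i) (rel_ne_zero i)

theorem two_mul_degree_le_weight (a : Fin P.k →₀ ℕ) :
    2 * a.degree ≤ Finsupp.weight P.deg a := by
  rw [Finsupp.degree_eq_sum, Finsupp.weight_apply, Finsupp.sum_fintype _ _ (by simp),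
    Finset.mul_sum]
  refine Finset.sum_le_sum fun i _ => ?_
  rw [smul_eq_mul, mul_comm]
  obtain ⟨c, hc⟩ := P.deg_even i
  have := P.deg_pos i
  exact Nat.mul_le_mul_left _ (by omega)

theorem four_le_relDeg (hP : P.IsPureModel) (i : Fin P.k) : 4 ≤ P.relDeg i := by
  obtain ⟨a, ha⟩ := support_nonempty.mpr (rel_ne_zero i)
  rw [← P.rel_homogeneous i (mem_support_iff.mp ha)]
  have := hP.two_le i a ha
  have := two_mul_degree_le_weight a
  omega

/-- Homogeneous elements of the ideal of relations have homogeneous coefficients. -/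
theorem exists_eq_sum_of_mem_relIdeal {f : MvPolynomial (Fin P.k) ℚ} {n : ℕ}
    (hf : f ∈ P.relIdeal) (hn : IsWeightedHomogeneous P.deg f n) :
    ∃ g : Fin P.k → MvPolynomial (Fin P.k) ℚ,
      (∀ i m, n = m + P.relDeg i → IsWeightedHomogeneous P.deg (g i) m) ∧
      (∀ i, n < P.relDeg i → g i = 0) ∧ f = ∑ i, g i * P.rel i := by
  obtain ⟨g, hg⟩ := (Submodule.mem_span_range_iff_exists_fun _).mp hf
  refine ⟨fun i => if P.relDeg i ≤ n then
    weightedHomogeneousComponent P.deg (n - P.relDeg i) (g i) else 0, fun i m hm => ?_,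
    fun i hi => ?_, ?_⟩
  · beta_reduce
    rw [if_pos (by omega), show n - P.relDeg i = m by omega]
    exact weightedHomogeneousComponent_isWeightedHomogeneous _ _
  · exact if_neg (not_le.mpr hi)
  · rw [← hn.weightedHomogeneousComponent_same, ← hg, map_sum]
    refine Finset.sum_congr rfl fun i _ => ?_
    rw [smul_eq_mul, weightedHomogeneousComponent_mul_of_isWeightedHomogeneous
      (P.rel_homogeneous i)]
    by_cases h : P.relDeg i ≤ n <;> simp only [h, if_true, if_false, zero_mul]

theorem mem_relSpan_four (hP : P.IsPureModel) {f : MvPolynomial (Fin P.k) ℚ}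
    (hf : f ∈ P.relIdeal) (hn : IsWeightedHomogeneous P.deg f 4) : f ∈ P.relSpan (· = 4) := by
  obtain ⟨g, hg, hg0, rfl⟩ := exists_eq_sum_of_mem_relIdeal hf hn
  refine Submodule.sum_mem _ fun i _ => ?_
  obtain h | h := (four_le_relDeg hP i).eq_or_lt
  · rw [eq_C_of_isWeightedHomogeneous_zero (hg i 0 (by omega)), C_mul']
    exact Submodule.smul_mem _ _ (rel_mem_relSpan h.symm)
  · rw [hg0 i h, zero_mul]
    exact Submodule.zero_mem _

/-- The weight of a monomial is at least twice its degree, with equality only if all its variables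
have degree 2. -/
theorem vars_deg_eq_two {f : MvPolynomial (Fin P.k) ℚ} {n : ℕ}
    (hf : IsWeightedHomogeneous P.deg f n) (h : ∀ a ∈ f.support, n ≤ 2 * a.degree)
    {a : Fin P.k →₀ ℕ} (ha : a ∈ f.support) {j : Fin P.k} (hj : P.deg j ≠ 2) : a j = 0 := by
  by_contra hne
  have h1 := hf (mem_support_iff.mp ha)
  have h2 := Finsupp.weight_sub_single_add (w := P.deg) hne
  have h3 := two_mul_degree_le_weight (a - Finsupp.single j 1)
  have h4 : (a - Finsupp.single j 1).degree + 1 = a.degree := by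
    conv_rhs => rw [← tsub_add_cancel_of_le (Finsupp.single_le_iff.mpr (Nat.one_le_iff_ne_zero.mpr
      hne))]
    rw [map_add, Finsupp.degree_single]
  have h5 := h a ha
  obtain ⟨c, hc⟩ := P.deg_even j
  have := P.deg_pos j
  omega

theorem derivation_eq_zero_of_degree
    {D : Derivation ℚ (MvPolynomial (Fin P.k) ℚ) (MvPolynomial (Fin P.k) ℚ)}
    (hD2 : ∀ j, P.deg j = 2 → D (X j) = 0) {f : MvPolynomial (Fin P.k) ℚ} {n : ℕ}
    (hf : IsWeightedHomogeneous P.deg f n) (h : ∀ a ∈ f.support, n ≤ 2 * a.degree) :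
    D f = 0 := by
  refine derivation_eq_zero_of_forall_mem_vars fun j hj => hD2 j ?_
  obtain ⟨a, ha, haj⟩ := (mem_vars_iff_mem_support j).mp hj
  by_contra hne
  exact (Finsupp.mem_support_iff.mp haj) (vars_deg_eq_two hf h ha hne)

theorem derivation_eq_zero_of_two
    {D : Derivation ℚ (MvPolynomial (Fin P.k) ℚ) (MvPolynomial (Fin P.k) ℚ)}
    (hD2 : ∀ j, P.deg j = 2 → D (X j) = 0) {f : MvPolynomial (Fin P.k) ℚ}
    (hf : IsWeightedHomogeneous P.deg f 2) : D f = 0 := by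
  refine derivation_eq_zero_of_degree hD2 hf fun a ha => ?_
  by_contra hlt
  have h1 := hf (mem_support_iff.mp ha)
  obtain rfl : a = 0 := (Finsupp.degree_eq_zero_iff a).mp (by omega)
  simp at h1

theorem derivation_rel_eq_zero (hP : P.IsPureModel)
    {D : Derivation ℚ (MvPolynomial (Fin P.k) ℚ) (MvPolynomial (Fin P.k) ℚ)}
    (hD2 : ∀ j, P.deg j = 2 → D (X j) = 0) {i : Fin P.k} (hi : P.relDeg i = 4) :
    D (P.rel i) = 0 :=
  derivation_eq_zero_of_degree hD2 (P.rel_homogeneous i) fun a ha => by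
    have := hP.two_le i a ha
    omega

/-- In degree 6 the ideal consists of relations of degree 6 and of products of relations of degree 4
with linear forms of degree 2. By purity the latter involve only variables of degree 2, so `D` kills
them. -/
theorem exists_add_of_mem_relIdeal_six (hP : P.IsPureModel)
    {D : Derivation ℚ (MvPolynomial (Fin P.k) ℚ) (MvPolynomial (Fin P.k) ℚ)}
    (hD2 : ∀ j, P.deg j = 2 → D (X j) = 0) {f : MvPolynomial (Fin P.k) ℚ}
    (hf : f ∈ P.relIdeal) (hn : IsWeightedHomogeneous P.deg f 6) :
    ∃ v ∈ P.relSpan (· = 6), ∃ z ∈ Ideal.span (P.relSpan (· = 4) : Set (MvPolynomial _ ℚ)),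
      D z = 0 ∧ f = v + z := by
  obtain ⟨g, hg, hg0, rfl⟩ := exists_eq_sum_of_mem_relIdeal hf hn
  have hterm : ∀ i, ∃ v ∈ P.relSpan (· = 6),
      ∃ z ∈ Ideal.span (P.relSpan (· = 4) : Set (MvPolynomial _ ℚ)),
      D z = 0 ∧ g i * P.rel i = v + z := by
    intro i
    have h4 := four_le_relDeg hP i
    obtain ⟨c, hc⟩ := even_relDeg i
    obtain h | h | h : P.relDeg i = 4 ∨ P.relDeg i = 6 ∨ 6 < P.relDeg i := by omega
    · refine ⟨0, Submodule.zero_mem _, g i * P.rel i,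
        Ideal.mul_mem_left _ _ (Ideal.subset_span (rel_mem_relSpan h)), ?_, (zero_add _).symm⟩
      rw [Derivation.leibniz, derivation_rel_eq_zero hP hD2 h,
        derivation_eq_zero_of_two hD2 (hg i 2 (by omega)), smul_zero, smul_zero, add_zero]
    · refine ⟨g i * P.rel i, ?_, 0, Ideal.zero_mem _, map_zero _, (add_zero _).symm⟩
      rw [eq_C_of_isWeightedHomogeneous_zero (hg i 0 (by omega)), C_mul']
      exact Submodule.smul_mem _ _ (rel_mem_relSpan h)
    · exact ⟨0, Submodule.zero_mem _, 0, Ideal.zero_mem _, map_zero _, by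
        rw [hg0 i h, zero_mul, zero_add]⟩
  choose v hv z hz hDz hvz using hterm
  refine ⟨∑ i, v i, Submodule.sum_mem _ fun i _ => hv i, ∑ i, z i,
    Ideal.sum_mem _ fun i _ => hz i, ?_, ?_⟩
  · rw [map_sum]
    exact Finset.sum_eq_zero fun i _ => hDz i
  · rw [← Finset.sum_add_distrib]
    exact Finset.sum_congr rfl fun i _ => hvz i

end PositivelyElliptic

/-! ### Linear forms and linear substitutions -/

theorem Finsupp.induction_single_one_add {σ : Type*} {p : (σ →₀ ℕ) → Prop} (h0 : p 0)
    (h : ∀ j a, p a → p (Finsupp.single j 1 + a)) (a : σ →₀ ℕ) : p a := by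
  induction a using Finsupp.induction with
  | zero => exact h0
  | single_add j n a _ _ ih =>
    clear * - h ih
    induction n with
    | zero => simpa using ih
    | succ n ihn =>
      rw [add_comm n 1, Finsupp.single_add, add_assoc]
      exact h j _ ihn

section LinForm

variable {σ : Type*} [Fintype σ]

/-- The linear form with given coefficients. -/
noncomputable def linForm : (σ → ℚ) →ₗ[ℚ] MvPolynomial σ ℚ :=
  Fintype.linearCombination ℚ X

theorem linForm_single [DecidableEq σ] (i : σ) (c : ℚ) : linForm (Pi.single i c) = c • X i :=
  Fintype.linearCombination_apply_single ℚ _ _ _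

theorem linForm_apply (v : σ → ℚ) : linForm v = ∑ i, v i • X i :=
  Fintype.linearCombination_apply ℚ _ _

theorem coeff_linForm [DecidableEq σ] (v : σ → ℚ) (i : σ) :
    coeff (Finsupp.single i 1) (linForm v) = v i := by
  rw [linForm_apply, coeff_sum, Finset.sum_eq_single i]
  · simp
  · intro j _ hj
    rw [coeff_smul, coeff_X, if_neg, smul_zero]
    exact fun h => hj (Finsupp.single_left_injective one_ne_zero h)
  · simp

theorem linForm_mem_idealOfVars (v : σ → ℚ) : linForm v ∈ idealOfVars σ ℚ := by
  rw [linForm_apply]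
  refine Ideal.sum_mem _ fun i _ => ?_
  rw [← C_mul']
  exact Ideal.mul_mem_left _ _ (Ideal.subset_span ⟨i, rfl⟩)

/-- Linear substitution of the variables. -/
noncomputable def linSubst [DecidableEq σ] (s : (σ → ℚ) →ₗ[ℚ] (σ → ℚ)) :
    MvPolynomial σ ℚ →ₐ[ℚ] MvPolynomial σ ℚ :=
  aeval fun i => linForm (s (Pi.single i 1))

variable [DecidableEq σ]

theorem linSubst_X (s : (σ → ℚ) →ₗ[ℚ] (σ → ℚ)) (i : σ) :
    linSubst s (X i) = linForm (s (Pi.single i 1)) :=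
  aeval_X _ _

theorem linSubst_linForm (s : (σ → ℚ) →ₗ[ℚ] (σ → ℚ)) (v : σ → ℚ) :
    linSubst s (linForm v) = linForm (s v) := by
  have : (linSubst s).toLinearMap ∘ₗ linForm = linForm ∘ₗ s := by
    refine LinearMap.pi_ext' fun i => LinearMap.ext_ring ?_
    simp [linForm_single, linSubst_X]
  exact LinearMap.congr_fun this v

/-- The kernel of a linear substitution is generated by linear forms. -/
theorem mem_span_of_linSubst_eq_zero (s : (σ → ℚ) →ₗ[ℚ] (σ → ℚ)) {f : MvPolynomial σ ℚ}
    (hf : linSubst s f = 0) :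
    f ∈ Ideal.span ((LinearMap.ker s).map linForm : Set (MvPolynomial σ ℚ)) := by
  -- A generalised inverse `t` with s t s = s: since v − t s v lies in the kernel of `s`, the
  -- quotient map factors through `linSubst s`.
  obtain ⟨g, hg⟩ := s.rangeRestrict.exists_rightInverse_of_surjective s.range_rangeRestrict
  obtain ⟨t, ht⟩ := g.exists_extend
  have hst : ∀ v, s (t (s v)) = s v := fun v => by
    have h1 : t (s v) = g (s.rangeRestrict v) := LinearMap.congr_fun ht (s.rangeRestrict v)
    rw [h1]
    exact congrArg Subtype.val (LinearMap.congr_fun hg (s.rangeRestrict v))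
  set I := Ideal.span ((LinearMap.ker s).map linForm : Set (MvPolynomial σ ℚ)) with hI
  have h : (Ideal.Quotient.mkₐ ℚ I) = ((Ideal.Quotient.mkₐ ℚ I).comp (linSubst t)).comp
      (linSubst s) := by
    refine MvPolynomial.algHom_ext fun i => ?_
    rw [AlgHom.comp_apply, AlgHom.comp_apply, linSubst_X, linSubst_linForm,
      Ideal.Quotient.mkₐ_eq_mk, Ideal.Quotient.eq]
    refine Ideal.subset_span ⟨Pi.single i 1 - t (s (Pi.single i 1)), ?_, ?_⟩
    · simp [hst]
    · rw [map_sub, linForm_single, one_smul]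
  rw [← Ideal.Quotient.eq_zero_iff_mem]
  have := AlgHom.congr_fun h f
  rwa [AlgHom.comp_apply, AlgHom.comp_apply, hf, map_zero, map_zero] at this

end LinForm

/-! ### Derivations of degree −2 compared with linear substitution -/

namespace PositivelyElliptic

variable {P : PositivelyElliptic}

theorem linForm_mem_relIdeal (hP : P.IsPureModel) {v : Fin P.k → ℚ}
    (h : linForm v ∈ P.relIdeal) : v = 0 := by
  ext i
  have h1 := relIdeal_le hP h
  rw [← coeff_linForm v i]
  by_contra hne
  have := (mem_pow_idealOfVars_iff 2 _).mp h1 (Finsupp.single i 1) (mem_support_iff.mpr hne)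
  simp at this

theorem exists_linForm_eq {f : MvPolynomial (Fin P.k) ℚ} (hf : IsWeightedHomogeneous P.deg f 2) :
    ∃ v : Fin P.k → ℚ, (∀ i, P.deg i ≠ 2 → v i = 0) ∧ linForm v = f := by
  have hsup : ∀ a ∈ f.support, ∃ i, P.deg i = 2 ∧ a = Finsupp.single i 1 := by
    intro a ha
    have h1 := hf (mem_support_iff.mp ha)
    have h2 := two_mul_degree_le_weight a
    have h3 : a.degree = 1 := by
      by_contra hne
      obtain rfl : a = 0 := (Finsupp.degree_eq_zero_iff a).mp (by omega)
      simp at h1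
    obtain ⟨i, rfl⟩ : a ∈ Set.range fun i => Finsupp.single i 1 := by
      rw [Finsupp.range_single_one]; exact h3
    refine ⟨i, ?_, rfl⟩
    simpa [Finsupp.weight_single] using h1
  refine ⟨fun i => coeff (Finsupp.single i 1) f, fun i hi => ?_, ?_⟩
  · by_contra hne
    exact hi (by simpa [Finsupp.weight_single] using hf hne)
  · rw [linForm_apply]
    ext a
    by_cases ha : ∃ i, a = Finsupp.single i 1
    · obtain ⟨i, rfl⟩ := ha
      rw [← linForm_apply, coeff_linForm]
    · rw [notMem_support_iff.mp fun h => ha ⟨_, (hsup a h).choose_spec.2⟩, coeff_sum]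
      refine Finset.sum_eq_zero fun i _ => ?_
      rw [coeff_smul, coeff_X, if_neg fun h => ha ⟨i, h.symm⟩, smul_zero]

/-- A derivation of degree `-2` of a polynomial ring with generators of degrees `2` and `4`
that preserves the ideal of relations. It is determined by an endomorphism of the space of linear
forms. -/
structure LoweringDerivation (P : PositivelyElliptic) where
  der : Derivation ℚ (MvPolynomial (Fin P.k) ℚ) (MvPolynomial (Fin P.k) ℚ)
  der_mem : ∀ f ∈ P.relIdeal, der f ∈ P.relIdeal
  map : (Fin P.k → ℚ) →ₗ[ℚ] (Fin P.k → ℚ)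
  der_linForm : ∀ v, der (linForm v) = linForm (map v)
  map_single : ∀ j, P.deg j = 2 → map (Pi.single j 1) = 0
  map_apply : ∀ v j, P.deg j = 4 → map v j = 0
  deg_cases : ∀ j, P.deg j = 2 ∨ P.deg j = 4

namespace LoweringDerivation

variable (L : P.LoweringDerivation)

theorem der_X (j : Fin P.k) : L.der (X j) = linForm (L.map (Pi.single j 1)) := by
  rw [← L.der_linForm, linForm_single, one_smul]

theorem der_X_of_deg_two (j : Fin P.k) (hj : P.deg j = 2) : L.der (X j) = 0 := by
  rw [L.der_X, L.map_single j hj, map_zero]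

theorem isWeightedHomogeneous_linForm_map (v : Fin P.k → ℚ) :
    IsWeightedHomogeneous P.deg (linForm (L.map v)) 2 := by
  rw [linForm_apply]
  refine (weightedHomogeneousSubmodule ℚ P.deg 2).sum_mem fun j _ => ?_
  obtain h | h := L.deg_cases j
  · exact Submodule.smul_mem _ _ (h ▸ isWeightedHomogeneous_X ℚ P.deg j)
  · rw [L.map_apply v j h, zero_smul]
    exact Submodule.zero_mem _

theorem map_map (v : Fin P.k → ℚ) : L.map (L.map v) = 0 := by
  have h : L.map v = ∑ j, L.map v j • Pi.single j 1 := pi_eq_sum_univ' _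
  rw [h, map_sum]
  refine Finset.sum_eq_zero fun j _ => ?_
  rw [map_smul]
  obtain h | h := L.deg_cases j
  · rw [L.map_single j h, smul_zero]
  · rw [L.map_apply v j h, zero_smul]

theorem isWeightedHomogeneous_der {f : MvPolynomial (Fin P.k) ℚ} {n : ℕ}
    (hf : IsWeightedHomogeneous P.deg f (n + 2)) : IsWeightedHomogeneous P.deg (L.der f) n := by
  have h := weightedHomogeneousComponent_derivation (w := P.deg) (D := L.der) (e := 2)
    (fun j m hm => by
      obtain h | h := L.deg_cases j
      · rw [L.der_X_of_deg_two j h]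
        exact isWeightedHomogeneous_zero _ _ _
      · obtain rfl : m = 2 := by omega
        rw [L.der_X]
        exact L.isWeightedHomogeneous_linForm_map _)
    (fun j hj => by
      obtain h | h := L.deg_cases j <;> omega) f n
  rw [hf.weightedHomogeneousComponent_same] at h
  rw [← h]
  exact weightedHomogeneousComponent_isWeightedHomogeneous _ _

/-- A monomial of weight 4 is either a variable of degree 4, or a product of variables of degree 2,
which both maps kill. The clause below weight 4 feeds the induction. -/
theorem der_monomial (a : Fin P.k →₀ ℕ) :
    (Finsupp.weight P.deg a < 4 → L.der (monomial a 1) = 0) ∧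
    (Finsupp.weight P.deg a = 4 → L.der (monomial a 1) = linSubst L.map (monomial a 1)) := by
  induction a using Finsupp.induction_single_one_add with
  | h0 => simp
  | h j a ih =>
    have hm : (monomial (Finsupp.single j 1 + a) 1 : MvPolynomial (Fin P.k) ℚ) =
        X j * monomial a 1 := by rw [X, monomial_mul, one_mul]
    have hw : Finsupp.weight P.deg (Finsupp.single j 1 + a) =
        P.deg j + Finsupp.weight P.deg a := by simp [Finsupp.weight_single]
    rw [hm, hw, Derivation.leibniz, map_mul, linSubst_X, ← L.der_X]
    obtain h | h := L.deg_cases j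
    · rw [L.der_X_of_deg_two j h, smul_zero, zero_mul, add_zero]
      exact ⟨fun hlt => by rw [ih.1 (by omega), smul_zero],
        fun heq => by rw [ih.1 (by omega), smul_zero]⟩
    · refine ⟨fun hlt => by omega, fun heq => ?_⟩
      have h1 := two_mul_degree_le_weight a
      obtain rfl : a = 0 := (Finsupp.degree_eq_zero_iff a).mp (by omega)
      simp

/-- The square of the derivation kills variables, so on a product of two variables of degree 4 only
the cross term survives, twice. Any other monomial of weight 8 has at most one variable of degree 4
and some variable of degree 2, so both sides vanish. -/
theorem der_der_monomial (a : Fin P.k →₀ ℕ) :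
    (Finsupp.weight P.deg a < 8 → L.der (L.der (monomial a 1)) = 0) ∧
    (Finsupp.weight P.deg a = 8 →
      L.der (L.der (monomial a 1)) = 2 * linSubst L.map (monomial a 1)) := by
  induction a using Finsupp.induction_single_one_add with
  | h0 => simp
  | h j a ih =>
    have hm : (monomial (Finsupp.single j 1 + a) 1 : MvPolynomial (Fin P.k) ℚ) =
        X j * monomial a 1 := by rw [X, monomial_mul, one_mul]
    have hw : Finsupp.weight P.deg (Finsupp.single j 1 + a) =
        P.deg j + Finsupp.weight P.deg a := by simp [Finsupp.weight_single]
    have hDD : L.der (L.der (X j)) = 0 := by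
      rw [L.der_X, L.der_linForm, L.map_map, map_zero]
    have hD : L.der (L.der (X j * monomial a 1)) = X j * L.der (L.der (monomial a 1)) +
        2 * (L.der (X j) * L.der (monomial a 1)) := by
      simp only [Derivation.leibniz, map_add, smul_eq_mul, hDD]
      ring
    rw [hm, hw, hD, map_mul, linSubst_X, ← L.der_X]
    obtain h | h := L.deg_cases j
    · rw [L.der_X_of_deg_two j h, zero_mul, zero_mul, mul_zero, add_zero]
      exact ⟨fun hlt => by rw [ih.1 (by omega), mul_zero],
        fun heq => by rw [ih.1 (by omega), mul_zero]⟩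
    · exact ⟨fun hlt => by
          rw [ih.1 (by omega), (L.der_monomial a).1 (by omega), mul_zero, mul_zero, mul_zero,
            add_zero],
        fun heq => by
          rw [ih.1 (by omega), (L.der_monomial a).2 (by omega), mul_zero, zero_add]⟩

theorem linSubst_monomial (a : Fin P.k →₀ ℕ) (ha : ¬ 4 ∣ Finsupp.weight P.deg a) :
    linSubst L.map (monomial a 1) = 0 := by
  revert ha
  induction a using Finsupp.induction_single_one_add with
  | h0 => simp
  | h j a ih =>
    have hm : (monomial (Finsupp.single j 1 + a) 1 : MvPolynomial (Fin P.k) ℚ) =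
        X j * monomial a 1 := by rw [X, monomial_mul, one_mul]
    have hw : Finsupp.weight P.deg (Finsupp.single j 1 + a) =
        P.deg j + Finsupp.weight P.deg a := by simp [Finsupp.weight_single]
    rw [hm, hw, map_mul, linSubst_X, ← L.der_X]
    obtain h | h := L.deg_cases j
    · rw [L.der_X_of_deg_two j h, zero_mul]
      exact fun _ => rfl
    · intro hd
      rw [ih (by omega), mul_zero]

theorem eq_of_forall_monomial {S T : MvPolynomial (Fin P.k) ℚ →ₗ[ℚ] MvPolynomial (Fin P.k) ℚ}
    {n : ℕ} (h : ∀ a, Finsupp.weight P.deg a = n → S (monomial a 1) = T (monomial a 1))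
    {f : MvPolynomial (Fin P.k) ℚ} (hf : IsWeightedHomogeneous P.deg f n) : S f = T f := by
  rw [f.as_sum, map_sum, map_sum]
  refine Finset.sum_congr rfl fun a ha => ?_
  rw [← mul_one (coeff a f), ← smul_eq_mul, ← smul_monomial, map_smul, map_smul,
    h a (hf (mem_support_iff.mp ha))]

theorem der_eq_linSubst {f : MvPolynomial (Fin P.k) ℚ} (hf : IsWeightedHomogeneous P.deg f 4) :
    L.der f = linSubst L.map f :=
  eq_of_forall_monomial (S := L.der) (T := (linSubst L.map).toLinearMap)
    (fun a ha => (L.der_monomial a).2 ha) hf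

theorem der_der_eq_linSubst {f : MvPolynomial (Fin P.k) ℚ}
    (hf : IsWeightedHomogeneous P.deg f 8) : L.der (L.der f) = 2 * linSubst L.map f :=
  eq_of_forall_monomial (S := L.der.toLinearMap ∘ₗ L.der.toLinearMap)
    (T := LinearMap.mulLeft ℚ 2 ∘ₗ (linSubst L.map).toLinearMap)
    (fun a ha => (L.der_der_monomial a).2 ha) hf

theorem linSubst_eq_zero {f : MvPolynomial (Fin P.k) ℚ} {n : ℕ} (hn : ¬ 4 ∣ n)
    (hf : IsWeightedHomogeneous P.deg f n) : linSubst L.map f = 0 :=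
  eq_of_forall_monomial (S := (linSubst L.map).toLinearMap) (T := 0)
    (fun a ha => L.linSubst_monomial a (ha ▸ hn)) hf

end LoweringDerivation

end PositivelyElliptic

/-! ### Inequalities between the rank and the numbers of relations -/

theorem LinearMap.exists_le_forall_eq {K M N : Type*} [Field K] [AddCommGroup M] [Module K M]
    [AddCommGroup N] [Module K N] (T : M →ₗ[K] N) (U : Submodule K M) [Module.Finite K U] :
    ∃ C ≤ U, Module.Finite K C ∧ Module.finrank K C ≤ Module.finrank K (U.map T) ∧
      ∀ u ∈ U, ∃ c ∈ C, T c = T u := by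
  set T' := T.domRestrict U with hT'
  obtain ⟨g, hg⟩ := T'.rangeRestrict.exists_rightInverse_of_surjective T'.range_rangeRestrict
  refine ⟨(LinearMap.range g).map U.subtype, Submodule.map_subtype_le _ _, inferInstance, ?_,
    fun u hu => ?_⟩
  · refine (Submodule.finrank_map_le _ _).trans ((LinearMap.finrank_range_le g).trans ?_)
    rw [hT', LinearMap.range_domRestrict]
  · refine ⟨g (T'.rangeRestrict ⟨u, hu⟩), ⟨_, ⟨_, rfl⟩, rfl⟩, ?_⟩
    exact congrArg Subtype.val (LinearMap.congr_fun hg (T'.rangeRestrict ⟨u, hu⟩))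

namespace PositivelyElliptic

namespace LoweringDerivation

variable {P : PositivelyElliptic} (L : P.LoweringDerivation)

/-- The rank of the endomorphism of the linear forms. -/
noncomputable def rank : ℕ := Module.finrank ℚ (LinearMap.range L.map)

/-- The image under the square of the derivation of the relations of degree `8`. -/
noncomputable def sqImage : Submodule ℚ (MvPolynomial (Fin P.k) ℚ) :=
  (P.relSpan (· = 8)).map (L.der.toLinearMap ∘ₗ L.der.toLinearMap)

/-- Set the variables of degree 2 to zero. Relations of degree not divisible by 4 vanish, and so do
those of degree 4, which have no linear terms. Krull applied to these variables and the remaining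
relations gives k ≤ a + s. -/
theorem card_deg_four_le (hP : P.IsPureModel) (hdeg : ∀ i, P.deg i = 2 ∨ P.deg i = 4) :
    (Finset.univ.filter fun i => P.deg i = 4).card ≤
      (Finset.univ.filter fun i => 4 ∣ P.relDeg i ∧ 8 ≤ P.relDeg i).card := by
  classical
  set S : Submodule ℚ (MvPolynomial (Fin P.k) ℚ) :=
    Submodule.span ℚ (((Finset.univ.filter fun i => P.deg i = 2).image X :
      Finset (MvPolynomial (Fin P.k) ℚ)) : Set (MvPolynomial (Fin P.k) ℚ)) with hS
  have hfS : Module.finrank ℚ S ≤ (Finset.univ.filter fun i => P.deg i = 2).card :=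
    (finrank_span_finset_le_card _).trans Finset.card_image_le
  have hSfin : Module.Finite ℚ S := Module.Finite.span_finset _ _
  have hcard : (Finset.univ.filter fun i => P.deg i = 2).card +
      (Finset.univ.filter fun i => P.deg i = 4).card = P.k := by
    rw [← Finset.card_union_of_disjoint (Finset.disjoint_filter.mpr fun i _ h => by omega),
      ← Finset.filter_or, Finset.filter_true_of_mem fun i _ => hdeg i, Finset.card_univ,
      Fintype.card_fin]
  have hle := le_finrank_of_rel_mem hP (S ⊔ P.relSpan fun n => 4 ∣ n ∧ 8 ≤ n) (fun f hf => ?_)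
    fun i => ?_
  · have := Submodule.finrank_add_le_finrank_add_finrank S (P.relSpan fun n => 4 ∣ n ∧ 8 ≤ n)
    rw [finrank_relSpan hP] at this
    omega
  · have : S ⊔ P.relSpan (fun n => 4 ∣ n ∧ 8 ≤ n) ≤
        (idealOfVars (Fin P.k) ℚ).restrictScalars ℚ := by
      refine sup_le (Submodule.span_le.mpr fun x hx => ?_) fun f hf => relSpan_le_idealOfVars hP hf
      obtain ⟨j, -, rfl⟩ := Finset.mem_image.mp (Finset.mem_coe.mp hx)
      exact Ideal.subset_span ⟨j, rfl⟩
    exact this hf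
  · by_cases h : 4 ∣ P.relDeg i ∧ 8 ≤ P.relDeg i
    · exact Ideal.subset_span (Submodule.mem_sup_right (rel_mem_relSpan h))
    · have hmem : P.rel i ∈ Ideal.span (X '' {j | P.deg j = 2} :
          Set (MvPolynomial (Fin P.k) ℚ)) := by
        rw [mem_ideal_span_X_image]
        intro a ha
        by_contra! hcon
        refine h ?_
        have hw := P.rel_homogeneous i (mem_support_iff.mp ha)
        have : Finsupp.weight P.deg a = 4 * a.degree := by
          rw [Finsupp.degree_eq_sum, Finsupp.weight_apply, Finsupp.sum_fintype _ _ (by simp),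
            Finset.mul_sum]
          refine Finset.sum_congr rfl fun j _ => ?_
          obtain hj | hj := hdeg j
          · rw [hcon j hj]
            simp
          · rw [hj, smul_eq_mul, mul_comm]
        have h2 := hP.two_le i a ha
        omega
      refine Ideal.span_mono ?_ hmem
      rintro _ ⟨j, hj, rfl⟩
      exact Submodule.mem_sup_left (Submodule.subset_span
        (Finset.mem_coe.mpr (Finset.mem_image_of_mem _ (by simpa using hj))))

theorem map_linForm_le_idealOfVars (W : Submodule ℚ (Fin P.k → ℚ)) :
    W.map linForm ≤ (idealOfVars (Fin P.k) ℚ).restrictScalars ℚ := by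
  rintro _ ⟨v, -, rfl⟩
  exact linForm_mem_idealOfVars v

/-- Work modulo the k − r linear forms in the kernel of the substitution x_j ↦ D(x_j). The
substitution kills all degrees not divisible by 4, agrees with D in degree 4, where it kills the
relations, and is D²/2 in degree 8. There remain t relations of degree at least 12 and, in degree 8,
a complement of dimension at most d to the kernel of D². Krull gives k ≤ (k − r) + t + d. -/
theorem rank_le (hP : P.IsPureModel) :
    L.rank ≤ (Finset.univ.filter fun i => 4 ∣ P.relDeg i ∧ 12 ≤ P.relDeg i).card +
      Module.finrank ℚ L.sqImage := by
  obtain ⟨C, hCle, hCfin, hC, hCT⟩ :=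
    (L.der.toLinearMap ∘ₗ L.der.toLinearMap).exists_le_forall_eq (P.relSpan (· = 8))
  have hk : L.rank + Module.finrank ℚ (LinearMap.ker L.map) = P.k := by
    rw [rank, LinearMap.finrank_range_add_finrank_ker]
    simp
  have h1 := Submodule.finrank_map_le (R := ℚ) linForm (LinearMap.ker L.map)
  set S := (LinearMap.ker L.map).map linForm with hS
  set R := P.relSpan fun n => 4 ∣ n ∧ 12 ≤ n with hR
  have hle := le_finrank_of_rel_mem hP (S ⊔ R ⊔ C) (fun f hf => ?_) fun i => ?_
  · have h2 := Submodule.finrank_add_le_finrank_add_finrank S R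
    have h3 := Submodule.finrank_add_le_finrank_add_finrank (S ⊔ R) C
    rw [hR, finrank_relSpan hP, ← hR] at h2
    change _ ≤ Module.finrank ℚ L.sqImage at hC
    omega
  · have : S ⊔ R ⊔ C ≤ (idealOfVars (Fin P.k) ℚ).restrictScalars ℚ :=
      sup_le (sup_le (map_linForm_le_idealOfVars _) fun f hf => relSpan_le_idealOfVars hP hf)
        fun f hf => relSpan_le_idealOfVars hP (hCle hf)
    exact this hf
  · have hker : ∀ f, linSubst L.map f = 0 → f ∈ Ideal.span ((S ⊔ R ⊔ C : Submodule ℚ _) :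
        Set (MvPolynomial (Fin P.k) ℚ)) := fun f hf => by
      refine Ideal.span_mono ?_ (mem_span_of_linSubst_eq_zero L.map hf)
      exact (le_sup_left.trans le_sup_left : S ≤ S ⊔ R ⊔ C)
    have h4 := four_le_relDeg hP i
    by_cases hd : 4 ∣ P.relDeg i
    · obtain h | h | h : P.relDeg i = 4 ∨ P.relDeg i = 8 ∨ 12 ≤ P.relDeg i := by omega
      · refine hker _ ?_
        rw [← L.der_eq_linSubst (h ▸ P.rel_homogeneous i)]
        exact derivation_rel_eq_zero hP L.der_X_of_deg_two h
      · obtain ⟨c, hc, hcT⟩ := hCT (P.rel i) (rel_mem_relSpan h)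
        rw [← sub_add_cancel (P.rel i) c]
        refine Ideal.add_mem _ (hker _ ?_) (Ideal.subset_span (Submodule.mem_sup_right hc))
        have h5 : IsWeightedHomogeneous P.deg (P.rel i - c) 8 :=
          isWeightedHomogeneous_of_mem_relSpan
            (Submodule.sub_mem _ (rel_mem_relSpan h) (hCle hc))
        have h6 := L.der_der_eq_linSubst h5
        rw [map_sub, map_sub] at h6
        rw [sub_eq_zero.mpr (show L.der (L.der (P.rel i)) = L.der (L.der c) from hcT.symm)] at h6
        exact (mul_eq_zero.mp h6.symm).resolve_left two_ne_zero
      · exact Ideal.subset_span (Submodule.mem_sup_left (Submodule.mem_sup_right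
          (rel_mem_relSpan ⟨hd, h⟩)))
    · exact hker _ (L.linSubst_eq_zero hd (P.rel_homogeneous i))

theorem sqImage_le_relSpan_four (hP : P.IsPureModel) : L.sqImage ≤ P.relSpan (· = 4) := by
  rintro _ ⟨u, hu, rfl⟩
  exact mem_relSpan_four hP
    (L.der_mem _ (L.der_mem _ (relSpan_le_restrictScalars _ hu)))
    (L.isWeightedHomogeneous_der (n := 4) (L.isWeightedHomogeneous_der (n := 6)
      (isWeightedHomogeneous_of_mem_relSpan hu)))

theorem exists_der_eq_add (hP : P.IsPureModel) {u : MvPolynomial (Fin P.k) ℚ}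
    (hu : u ∈ P.relSpan (· = 8)) :
    ∃ v ∈ P.relSpan (· = 6), ∃ z ∈ Ideal.span (P.relSpan (· = 4) : Set (MvPolynomial _ ℚ)),
      L.der z = 0 ∧ L.der u = v + z :=
  exists_add_of_mem_relIdeal_six hP L.der_X_of_deg_two
    (L.der_mem _ (relSpan_le_restrictScalars _ hu))
    (L.isWeightedHomogeneous_der (n := 6) (isWeightedHomogeneous_of_mem_relSpan hu))

/-- The derivative of a relation of degree 8 is a relation of degree 6 up to terms that the
derivation kills. -/
theorem sqImage_le_map_relSpan_six (hP : P.IsPureModel) :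
    L.sqImage ≤ (P.relSpan (· = 6)).map L.der.toLinearMap := by
  rintro _ ⟨u, hu, rfl⟩
  obtain ⟨v, hv, z, -, hz, h⟩ := L.exists_der_eq_add hP hu
  refine ⟨v, hv, ?_⟩
  change L.der v = L.der (L.der u)
  rw [h, map_add, hz, add_zero]

theorem finrank_sqImage_le_four (hP : P.IsPureModel) :
    Module.finrank ℚ L.sqImage ≤ (Finset.univ.filter fun i => P.relDeg i = 4).card := by
  rw [← finrank_relSpan hP (· = 4)]
  exact Submodule.finrank_mono (L.sqImage_le_relSpan_four hP)

theorem finrank_sqImage_le_six (hP : P.IsPureModel) :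
    Module.finrank ℚ L.sqImage ≤ (Finset.univ.filter fun i => P.relDeg i = 6).card := by
  rw [← finrank_relSpan hP (· = 6)]
  exact (Submodule.finrank_mono (L.sqImage_le_map_relSpan_six hP)).trans
    (Submodule.finrank_map_le _ _)

theorem der_mem_span (f : MvPolynomial (Fin P.k) ℚ) :
    L.der f ∈ Ideal.span ((LinearMap.range L.map).map linForm : Set (MvPolynomial (Fin P.k) ℚ)) := by
  rw [derivation_apply_eq_sum_pderiv]
  refine Ideal.sum_mem _ fun j _ => Ideal.mul_mem_left _ _ (Ideal.subset_span ?_)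
  rw [L.der_X]
  exact ⟨_, ⟨_, rfl⟩, rfl⟩

/-- When both bounds on d are equalities, all relations of degrees 4 and 6 lie in the ideal
generated by the r linear forms in the range of `L.map`. These forms can replace the p + q
relations, and Krull gives k ≤ r + (k − p − q). -/
theorem card_add_card_le_rank (hP : P.IsPureModel)
    (h4 : (Finset.univ.filter fun i => P.relDeg i = 4).card = Module.finrank ℚ L.sqImage)
    (h6 : (Finset.univ.filter fun i => P.relDeg i = 6).card = Module.finrank ℚ L.sqImage) :
    (Finset.univ.filter fun i => P.relDeg i = 4).card +
      (Finset.univ.filter fun i => P.relDeg i = 6).card ≤ L.rank := by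
  set J := Ideal.span ((LinearMap.range L.map).map linForm : Set (MvPolynomial (Fin P.k) ℚ))
    with hJ
  have hU4 : L.sqImage = P.relSpan (· = 4) :=
    Submodule.eq_of_le_of_finrank_eq (L.sqImage_le_relSpan_four hP)
      (by rw [finrank_relSpan hP, h4])
  have hU4J : ∀ f ∈ P.relSpan (· = 4), f ∈ J := by
    rw [← hU4]
    rintro _ ⟨u, -, rfl⟩
    exact L.der_mem_span _
  have hU6 : L.sqImage = (P.relSpan (· = 6)).map L.der.toLinearMap := by
    refine Submodule.eq_of_le_of_finrank_le (L.sqImage_le_map_relSpan_six hP) ?_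
    rw [← h6, ← finrank_relSpan hP (· = 6)]
    exact Submodule.finrank_map_le _ _
  have hinj : ∀ f ∈ P.relSpan (· = 6), L.der f = 0 → f = 0 := by
    intro f hf hf0
    have h := (L.der.toLinearMap.domRestrict (P.relSpan (· = 6))).finrank_range_add_finrank_ker
    rw [LinearMap.range_domRestrict, ← hU6, ← h6, finrank_relSpan hP, add_eq_left,
      Submodule.finrank_eq_zero] at h
    have h' : (⟨f, hf⟩ : P.relSpan (· = 6)) ∈
      LinearMap.ker (L.der.toLinearMap.domRestrict (P.relSpan (· = 6))) := hf0
    rw [h, Submodule.mem_bot] at h'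
    exact congrArg Subtype.val h'
  -- Here D(f) = D²(u) and D(u) = v + z with D(z) = 0, so injectivity in degree 6 gives f = v = D(u)
  -- − z. Both terms lie in `J`.
  have hU6J : ∀ f ∈ P.relSpan (· = 6), f ∈ J := by
    intro f hf
    obtain ⟨u, hu, huf⟩ : L.der f ∈ L.sqImage := hU6 ▸ ⟨f, hf, rfl⟩
    obtain ⟨v, hv, z, hzJ, hz, h⟩ := L.exists_der_eq_add hP hu
    have hfv : f - v = 0 := by
      refine hinj _ (Submodule.sub_mem _ hf hv) ?_
      rw [map_sub, ← huf]
      change L.der (L.der u) - _ = 0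
      rw [h, map_add, hz, add_zero, sub_self]
    rw [sub_eq_zero.mp hfv, eq_sub_of_add_eq h.symm]
    exact Ideal.sub_mem _ (L.der_mem_span _) (Ideal.span_le.mpr hU4J hzJ)
  set S := (LinearMap.range L.map).map linForm with hS
  have h1 : Module.finrank ℚ S ≤ L.rank := Submodule.finrank_map_le (R := ℚ) linForm _
  set R := P.relSpan fun n => ¬ (n = 4 ∨ n = 6) with hR
  have hle := le_finrank_of_rel_mem hP (S ⊔ R) (fun f hf => ?_) fun i => ?_
  · have h2 := Submodule.finrank_add_le_finrank_add_finrank S R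
    rw [hR, finrank_relSpan hP, ← hR] at h2
    have h3 := Finset.card_filter_add_card_filter_not (s := Finset.univ)
      (fun i => P.relDeg i = 4 ∨ P.relDeg i = 6)
    rw [Finset.filter_or, Finset.card_union_of_disjoint
      (Finset.disjoint_filter.mpr fun i _ h => by omega), Finset.card_univ, Fintype.card_fin] at h3
    omega
  · have : S ⊔ R ≤ (idealOfVars (Fin P.k) ℚ).restrictScalars ℚ :=
      sup_le (map_linForm_le_idealOfVars _) fun f hf => relSpan_le_idealOfVars hP hf
    exact this hf
  · have hJle : J ≤ Ideal.span ((S ⊔ R : Submodule ℚ _) : Set (MvPolynomial (Fin P.k) ℚ)) :=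
      Ideal.span_mono (le_sup_left (a := S))
    by_cases h : P.relDeg i = 4 ∨ P.relDeg i = 6
    · obtain h | h := h
      · exact hJle (hU4J _ (rel_mem_relSpan h))
      · exact hJle (hU6J _ (rel_mem_relSpan h))
    · exact Ideal.subset_span (Submodule.mem_sup_right (rel_mem_relSpan h))

end LoweringDerivation

end PositivelyElliptic

/-! ### Consequences of the obstruction -/

namespace PositivelyElliptic

namespace LoweringDerivation

variable {P : PositivelyElliptic} (L : P.LoweringDerivation)

theorem false_of_mul_der_X_sub_mem (hP : P.IsPureModel) {b σ : MvPolynomial (Fin P.k) ℚ}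
    (hb : L.der b = 0) (hσ : σ ∉ P.relIdeal) {c : Fin P.k → ℚ}
    (hc : ∀ j, b * L.der (X j) - C (c j) * σ ∈ P.relIdeal) {i : Fin P.k} (hci : c i ≠ 0) :
    False := by
  refine false_of_mul_derivation_X_sub_mem hP (e := 2) two_pos (fun j n hj => ?_) (fun j hj => ?_)
    L.der_mem hb hσ hc hci
  · exact L.isWeightedHomogeneous_der (hj ▸ isWeightedHomogeneous_X ℚ P.deg j)
  · obtain h | h := L.deg_cases j <;> omega

/-- In rank 1 all D(x_j) are multiples of one linear form, which purity keeps out of the ideal, so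
the obstruction applies with multiplier 1. -/
theorem two_le_rank (hP : P.IsPureModel) {j : Fin P.k} (hj : L.der (X j) ∉ P.relIdeal) :
    2 ≤ L.rank := by
  by_contra hlt
  have hne : L.map (Pi.single j 1) ≠ 0 := fun h => hj (by
    rw [L.der_X, h, map_zero]
    exact Ideal.zero_mem _)
  obtain h | h : L.rank = 0 ∨ L.rank = 1 := by omega
  · rw [rank, Submodule.finrank_eq_zero] at h
    exact hne ((Submodule.mem_bot ℚ).mp (h ▸ ⟨_, rfl⟩))
  · obtain ⟨⟨w, hw⟩, hw0, hspan⟩ := finrank_eq_one_iff'.mp h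
    have hc : ∀ i, ∃ c : ℚ, c • w = L.map (Pi.single i 1) := fun i =>
      (hspan ⟨_, Pi.single i 1, rfl⟩).imp fun c hc => congrArg Subtype.val hc
    choose c hc using hc
    refine L.false_of_mul_der_X_sub_mem hP (b := 1) (σ := linForm w) (c := c) (by simp)
      (fun h => hw0 (Subtype.ext (linForm_mem_relIdeal hP h))) (fun i => ?_) (i := j) fun h => ?_
    · rw [L.der_X, ← hc i, map_smul, one_mul, C_mul', sub_self]
      exact Ideal.zero_mem _
    · exact hne (by rw [← hc j, h, zero_smul])

theorem range_map_le_span : LinearMap.range L.map ≤ Submodule.span ℚ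
    (((Finset.univ.filter fun i => P.deg i = 2).image fun j => Pi.single j 1 :
      Finset (Fin P.k → ℚ)) : Set (Fin P.k → ℚ)) := by
  rintro _ ⟨v, rfl⟩
  have h : L.map v = ∑ j, L.map v j • Pi.single j 1 := pi_eq_sum_univ' _
  rw [h]
  refine Submodule.sum_mem _ fun j _ => ?_
  obtain hj | hj := L.deg_cases j
  · exact Submodule.smul_mem _ _ (Submodule.subset_span
      (Finset.mem_coe.mpr (Finset.mem_image_of_mem _ (by simpa using hj))))
  · rw [L.map_apply v j hj, zero_smul]
    exact Submodule.zero_mem _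

theorem rank_le_card_deg_two : L.rank ≤ (Finset.univ.filter fun i => P.deg i = 2).card :=
  (Submodule.finrank_mono L.range_map_le_span).trans
    ((finrank_span_finset_le_card _).trans Finset.card_image_le)

theorem rank_le_card_deg_four : L.rank ≤ (Finset.univ.filter fun i => P.deg i = 4).card := by
  classical
  have hle : LinearMap.range L.map ≤ Submodule.span ℚ
      (((Finset.univ.filter fun i => P.deg i = 4).image fun j => L.map (Pi.single j 1) :
        Finset (Fin P.k → ℚ)) : Set (Fin P.k → ℚ)) := by
    rintro _ ⟨v, rfl⟩
    have h : v = ∑ j, v j • Pi.single j 1 := pi_eq_sum_univ' _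
    rw [h, map_sum]
    refine Submodule.sum_mem _ fun j _ => ?_
    rw [map_smul]
    obtain hj | hj := L.deg_cases j
    · rw [L.map_single j hj, smul_zero]
      exact Submodule.zero_mem _
    · exact Submodule.smul_mem _ _ (Submodule.subset_span
        (Finset.mem_coe.mpr (Finset.mem_image_of_mem _ (by simpa using hj))))
  exact (Submodule.finrank_mono hle).trans
    ((finrank_span_finset_le_card _).trans Finset.card_image_le)

theorem exists_single_add_single {f : MvPolynomial (Fin P.k) ℚ} (hP : P.IsPureModel)
    (hf : f ∈ P.relSpan (· = 4)) {a : Fin P.k →₀ ℕ} (ha : a ∈ f.support) :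
    ∃ i j, P.deg i = 2 ∧ P.deg j = 2 ∧ a = Finsupp.single i 1 + Finsupp.single j 1 := by
  have hwh := isWeightedHomogeneous_of_mem_relSpan hf
  have hdeg : ∀ b ∈ f.support, 2 ≤ b.degree := fun b hb =>
    (mem_pow_idealOfVars_iff 2 _).mp (relIdeal_le hP (relSpan_le_restrictScalars _ hf)) b hb
  have hvar : ∀ i, a i ≠ 0 → P.deg i = 2 := fun i hi => by
    by_contra hne
    exact hi (vars_deg_eq_two hwh (fun b hb => by have := hdeg b hb; omega) ha hne)
  have h2 : a.degree = 2 := by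
    have h1 := hdeg a ha
    have h2 := two_mul_degree_le_weight a
    rw [hwh (mem_support_iff.mp ha)] at h2
    omega
  have ha0 : a ≠ 0 := by
    rintro rfl
    simp at h2
  obtain ⟨i, hi⟩ := Finsupp.ne_iff.mp ha0
  obtain ⟨b, rfl⟩ := exists_add_of_le (Finsupp.single_le_iff.mpr (Nat.one_le_iff_ne_zero.mpr hi))
  rw [map_add, Finsupp.degree_single] at h2
  obtain ⟨j, rfl⟩ : b ∈ Set.range fun j => Finsupp.single j 1 := by
    rw [Finsupp.range_single_one]
    exact Nat.add_left_cancel h2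
  exact ⟨i, j, hvar i hi, hvar j (by simp), rfl⟩

/-- Quadratic forms in two variables have dimension 3, so two quadratic relations leave a line.
Multiplying the D(x_j) by a suitable variable x_l of degree 2 puts them all on this line, and the
obstruction applies. -/
theorem false_of_card_eq_two (hP : P.IsPureModel)
    (h2 : (Finset.univ.filter fun i => P.deg i = 2).card = 2)
    (h4 : (Finset.univ.filter fun i => P.relDeg i = 4).card = 2) (hr : 2 ≤ L.rank) : False := by
  classical
  have hrange : LinearMap.range L.map = Submodule.span ℚ
      (((Finset.univ.filter fun i => P.deg i = 2).image fun j => Pi.single j 1 :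
        Finset (Fin P.k → ℚ)) : Set (Fin P.k → ℚ)) := by
    refine Submodule.eq_of_le_of_finrank_le L.range_map_le_span ?_
    exact ((finrank_span_finset_le_card _).trans Finset.card_image_le).trans (h2.trans_le hr)
  have hsingle : ∀ m, P.deg m = 2 → ∃ v, L.map v = Pi.single m 1 := fun m hm => by
    have : Pi.single m 1 ∈ LinearMap.range L.map := hrange ▸ Submodule.subset_span
      (Finset.mem_coe.mpr (Finset.mem_image_of_mem _ (by simpa using hm)))
    exact this
  obtain ⟨j₁, j₂, hne, hfil⟩ := Finset.card_eq_two.mp h2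
  have hj' : ∀ i, P.deg i = 2 → i = j₁ ∨ i = j₂ := fun i hi => by
    have : i ∈ Finset.univ.filter fun i => P.deg i = 2 := by simpa using hi
    simpa [hfil] using this
  set a : Fin 3 → (Fin P.k →₀ ℕ) := ![Finsupp.single j₁ 1 + Finsupp.single j₁ 1,
    Finsupp.single j₁ 1 + Finsupp.single j₂ 1, Finsupp.single j₂ 1 + Finsupp.single j₂ 1] with ha
  -- The exponent of `j₁` distinguishes the three monomials.
  have hinj : Function.Injective a := by
    have h : (fun i => a i j₁) = ![2, 1, 0] := by
      funext i
      fin_cases i <;> simp [ha, hne.symm]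
    refine Function.Injective.of_comp (f := fun b : Fin P.k →₀ ℕ => b j₁) ?_
    change Function.Injective (fun i => a i j₁)
    rw [h]
    decide
  have hli : LinearIndependent ℚ fun i => (monomial (a i) 1 : MvPolynomial (Fin P.k) ℚ) := by
    have := (basisMonomials (Fin P.k) ℚ).linearIndependent.comp a hinj
    simpa [Function.comp_def] using this
  set T := Submodule.span ℚ (Set.range fun i =>
    (monomial (a i) 1 : MvPolynomial (Fin P.k) ℚ)) with hT
  have hTfin : Module.Finite ℚ T := Module.Finite.span_of_finite ℚ (Set.finite_range _)
  have hT3 : Module.finrank ℚ T = 3 := by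
    rw [hT, finrank_span_eq_card hli, Fintype.card_fin]
  have hmulT : ∀ i j, P.deg i = 2 → P.deg j = 2 →
      monomial (Finsupp.single i 1 + Finsupp.single j 1) (1 : ℚ) ∈ T := by
    intro i j hi hj
    obtain rfl | rfl := hj' i hi <;> obtain rfl | rfl := hj' j hj
    · exact Submodule.subset_span ⟨0, rfl⟩
    · exact Submodule.subset_span ⟨1, rfl⟩
    · rw [add_comm]
      exact Submodule.subset_span ⟨1, rfl⟩
    · exact Submodule.subset_span ⟨2, rfl⟩
  have hXX : ∀ i j, (X i * X j : MvPolynomial (Fin P.k) ℚ) =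
      monomial (Finsupp.single i 1 + Finsupp.single j 1) 1 := fun i j => by
    rw [X, X, monomial_mul, one_mul]
  have hUT : P.relSpan (· = 4) ≤ T := by
    intro f hf
    rw [f.as_sum]
    refine Submodule.sum_mem _ fun b hb => ?_
    obtain ⟨i, j, hi, hj, rfl⟩ := exists_single_add_single hP hf hb
    rw [← mul_one (coeff _ f), ← smul_eq_mul, ← smul_monomial]
    exact Submodule.smul_mem _ _ (hmulT i j hi hj)
  have hU2 : Module.finrank ℚ (P.relSpan (· = 4)) = 2 := by rw [finrank_relSpan hP, h4]
  obtain ⟨l, m, hl, hm, hlm⟩ : ∃ l m, P.deg l = 2 ∧ P.deg m = 2 ∧ X l * X m ∉ P.relIdeal := by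
    by_contra! hcon
    have hj₁ : P.deg j₁ = 2 := by
      have : j₁ ∈ Finset.univ.filter fun i => P.deg i = 2 := by simp [hfil]
      simpa using this
    have hj₂ : P.deg j₂ = 2 := by
      have : j₂ ∈ Finset.univ.filter fun i => P.deg i = 2 := by simp [hfil]
      simpa using this
    have hmem : ∀ i j, P.deg i = 2 → P.deg j = 2 →
        monomial (Finsupp.single i 1 + Finsupp.single j 1) (1 : ℚ) ∈ P.relSpan (· = 4) := by
      intro i j hi hj
      rw [← hXX]
      refine mem_relSpan_four hP (hcon i j hi hj) ?_
      have := (isWeightedHomogeneous_X ℚ P.deg i).mul (isWeightedHomogeneous_X ℚ P.deg j)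
      rwa [hi, hj] at this
    have hle : T ≤ P.relSpan (· = 4) := by
      refine Submodule.span_le.mpr ?_
      rintro _ ⟨i, rfl⟩
      fin_cases i
      · exact hmem j₁ j₁ hj₁ hj₁
      · exact hmem j₁ j₂ hj₁ hj₂
      · exact hmem j₂ j₂ hj₂ hj₂
    have := Submodule.finrank_mono hle
    omega
  obtain ⟨v, hv⟩ := hsingle m hm
  -- The rank is full, so `X m` is a combination of the derivatives of the variables; they cannot
  -- all be killed by `X l`.
  obtain ⟨i, hi⟩ : ∃ i, X l * L.der (X i) ∉ P.relIdeal := by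
    by_contra! hcon
    refine hlm ?_
    have h : (X m : MvPolynomial (Fin P.k) ℚ) = L.der (linForm v) := by
      rw [L.der_linForm, hv, linForm_single, one_smul]
    rw [h, linForm_apply, map_sum, Finset.mul_sum]
    refine Ideal.sum_mem _ fun j _ => ?_
    rw [Derivation.map_smul, mul_smul_comm, ← C_mul']
    exact Ideal.mul_mem_left _ _ (hcon j)
  have hmem : ∀ j, X l * L.der (X j) ∈ T := by
    intro j
    rw [L.der_X, linForm_apply, Finset.mul_sum]
    refine Submodule.sum_mem _ fun n _ => ?_
    rw [mul_smul_comm, hXX]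
    obtain hn | hn := L.deg_cases n
    · exact Submodule.smul_mem _ _ (hmulT l n hl hn)
    · rw [L.map_apply _ n hn, zero_smul]
      exact Submodule.zero_mem _
  have hsup : P.relSpan (· = 4) ⊔ Submodule.span ℚ {X l * L.der (X i)} = T := by
    have hle : P.relSpan (· = 4) ⊔ Submodule.span ℚ {X l * L.der (X i)} ≤ T :=
      sup_le hUT (Submodule.span_le.mpr (Set.singleton_subset_iff.mpr (hmem i)))
    have hlt : P.relSpan (· = 4) < P.relSpan (· = 4) ⊔ Submodule.span ℚ {X l * L.der (X i)} := by
      refine lt_of_le_of_ne le_sup_left fun h => hi ?_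
      refine relSpan_le_restrictScalars (· = 4) ?_
      rw [h]
      exact Submodule.mem_sup_right (Submodule.mem_span_singleton_self _)
    refine Submodule.eq_of_le_of_finrank_le hle ?_
    have := Submodule.finrank_lt_finrank_of_lt hlt
    omega
  have hc : ∀ j, ∃ c : ℚ, X l * L.der (X j) - C c * (X l * L.der (X i)) ∈ P.relIdeal := by
    intro j
    have h := hmem j
    rw [← hsup] at h
    obtain ⟨u, hu, w, hw, huw⟩ := Submodule.mem_sup.mp h
    obtain ⟨c, rfl⟩ := Submodule.mem_span_singleton.mp hw
    refine ⟨c, ?_⟩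
    rw [C_mul', ← huw, add_sub_cancel_right]
    exact relSpan_le_restrictScalars _ hu
  choose c hc using hc
  refine L.false_of_mul_der_X_sub_mem hP (L.der_X_of_deg_two l hl) hi hc (i := i) fun h => ?_
  have := hc i
  rw [h, C_0, zero_mul, sub_zero] at this
  exact hi this

end LoweringDerivation

theorem HasNegativeDerivation.exists_loweringDerivation {P : PositivelyElliptic}
    (hP : P.IsPureModel) (hdeg : ∀ i, P.deg i = 2 ∨ P.deg i = 4) (h : P.HasNegativeDerivation) :
    ∃ (L : P.LoweringDerivation) (j : Fin P.k), L.der (X j) ∉ P.relIdeal := by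
  obtain ⟨D, e, he, hD, hD0, hDI, j, hj⟩ := h.exists_lift hP
  have hje : e < P.deg j := by
    by_contra hle
    rw [hD0 j (not_lt.mp hle)] at hj
    exact hj (Ideal.zero_mem _)
  -- Since `2 ≤ e < 4`, the only alternative is 3, which would put a non-zero polynomial in the odd
  -- degree 1.
  obtain rfl : e = 2 := by
    by_contra hne
    have hj4 := hdeg j
    have h1 : Even 1 := even_of_isWeightedHomogeneous (hD j 1 (by omega)) fun h0 => hj (by
      rw [h0]
      exact Ideal.zero_mem _)
    simp at h1
  have hc : ∀ j, ∃ v : Fin P.k → ℚ, (∀ i, P.deg i = 4 → v i = 0) ∧ (P.deg j = 2 → v = 0) ∧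
      linForm v = D (X j) := by
    intro j
    obtain h | h := hdeg j
    · exact ⟨0, fun _ _ => rfl, fun _ => rfl, by rw [map_zero, hD0 j h.le]⟩
    · obtain ⟨v, hv, hvD⟩ := exists_linForm_eq (hD j 2 h)
      exact ⟨v, fun i hi => hv i (by omega), fun h' => by omega, hvD⟩
  choose c hc4 hc2 hcD using hc
  refine ⟨⟨D, hDI, Fintype.linearCombination ℚ c, fun v => ?_, fun j hj => ?_, fun v j hj => ?_,
    hdeg⟩, j, hj⟩
  · rw [linForm_apply, map_sum, Fintype.linearCombination_apply, map_sum]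
    exact Finset.sum_congr rfl fun i _ => by rw [Derivation.map_smul, map_smul, hcD]
  · rw [Fintype.linearCombination_apply_single, hc2 j hj, smul_zero]
  · rw [Fintype.linearCombination_apply, Finset.sum_apply]
    exact Finset.sum_eq_zero fun i _ => by rw [Pi.smul_apply, hc4 i j hj, smul_zero]

end PositivelyElliptic

/-! ### From counts of degrees to the degree lists -/

theorem ofFn_eq_of_card_filter_four {d : Fin 4 → ℕ} (hd : Monotone d)
    (h : ∀ i, d i = 2 ∨ d i = 4) (h2 : (Finset.univ.filter fun i => d i = 2).card = 2) :
    List.ofFn d = [2, 2, 4, 4] := by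
  have h01 : d 0 ≤ d 1 := hd (by decide)
  have h12 : d 1 ≤ d 2 := hd (by decide)
  have h23 : d 2 ≤ d 3 := hd (by decide)
  rw [Finset.card_filter, Fin.sum_univ_four] at h2
  obtain h0 | h0 := h 0 <;> obtain h1 | h1 := h 1 <;> obtain h2' | h2' := h 2 <;>
    obtain h3 | h3 := h 3 <;> simp_all [List.ofFn_succ]

theorem ofFn_eq_of_card_filter_five {d : Fin 5 → ℕ} (hd : Monotone d)
    (h : ∀ i, d i = 2 ∨ d i = 4) (h2 : (Finset.univ.filter fun i => d i = 2).card = 3) :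
    List.ofFn d = [2, 2, 2, 4, 4] := by
  have h01 : d 0 ≤ d 1 := hd (by decide)
  have h12 : d 1 ≤ d 2 := hd (by decide)
  have h23 : d 2 ≤ d 3 := hd (by decide)
  have h34 : d 3 ≤ d 4 := hd (by decide)
  rw [Finset.card_filter, Fin.sum_univ_five] at h2
  obtain h0 | h0 := h 0 <;> obtain h1 | h1 := h 1 <;> obtain h2' | h2' := h 2 <;>
    obtain h3 | h3 := h 3 <;> obtain h4 | h4 := h 4 <;> simp_all [List.ofFn_succ]

/-- Evaluating all four counting indicators on each class of degrees reduces statements about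
cardinalities to linear arithmetic. -/
theorem even_cases {n : ℕ} (h4 : 4 ≤ n) (hn : Even n) :
    (n = 4 ∧ (if n = 4 then 1 else 0) = 1 ∧ (if n = 6 then 1 else 0) = 0 ∧
      (if 4 ∣ n ∧ 8 ≤ n then 1 else 0) = 0 ∧ (if 4 ∣ n ∧ 12 ≤ n then 1 else 0) = 0) ∨
    (n = 6 ∧ (if n = 4 then 1 else 0) = 0 ∧ (if n = 6 then 1 else 0) = 1 ∧
      (if 4 ∣ n ∧ 8 ≤ n then 1 else 0) = 0 ∧ (if 4 ∣ n ∧ 12 ≤ n then 1 else 0) = 0) ∨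
    (n = 8 ∧ (if n = 4 then 1 else 0) = 0 ∧ (if n = 6 then 1 else 0) = 0 ∧
      (if 4 ∣ n ∧ 8 ≤ n then 1 else 0) = 1 ∧ (if 4 ∣ n ∧ 12 ≤ n then 1 else 0) = 0) ∨
    (10 ≤ n ∧ (if n = 4 then 1 else 0) = 0 ∧ (if n = 6 then 1 else 0) = 0 ∧
      (if 4 ∣ n ∧ 8 ≤ n then 1 else 0) = 0 ∧ (if 4 ∣ n ∧ 12 ≤ n then 1 else 0) = 0) ∨
    (12 ≤ n ∧ 4 ∣ n ∧ (if n = 4 then 1 else 0) = 0 ∧ (if n = 6 then 1 else 0) = 0 ∧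
      (if 4 ∣ n ∧ 8 ≤ n then 1 else 0) = 1 ∧ (if 4 ∣ n ∧ 12 ≤ n then 1 else 0) = 1) := by
  obtain ⟨m, rfl⟩ := hn
  split_ifs <;> omega

theorem ofFn_relDeg_eq_of_card_filter_four {r : Fin 4 → ℕ} (hr : Monotone r) (h4 : ∀ i, 4 ≤ r i)
    (hev : ∀ i, Even (r i)) (hp : (Finset.univ.filter fun i => r i = 4).card = 1)
    (hq : (Finset.univ.filter fun i => r i = 6).card = 1)
    (hs : (Finset.univ.filter fun i => 4 ∣ r i ∧ 8 ≤ r i).card = 2)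
    (ht : (Finset.univ.filter fun i => 4 ∣ r i ∧ 12 ≤ r i).card = 1) (hsum : ∑ i, r i ≤ 32) :
    List.ofFn r = [4, 6, 8, 12] := by
  have h01 : r 0 ≤ r 1 := hr (by decide)
  have h12 : r 1 ≤ r 2 := hr (by decide)
  have h23 : r 2 ≤ r 3 := hr (by decide)
  rw [Finset.card_filter, Fin.sum_univ_four] at hp hq hs ht
  rw [Fin.sum_univ_four] at hsum
  suffices h : r 0 = 4 ∧ r 1 = 6 ∧ r 2 = 8 ∧ r 3 = 12 by
    simp [List.ofFn_succ, h.1, h.2.1, h.2.2.1, ← h.2.2.2]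
  obtain c0 | c0 | c0 | c0 | c0 := even_cases (h4 0) (hev 0) <;> try omega
  all_goals obtain c1 | c1 | c1 | c1 | c1 := even_cases (h4 1) (hev 1) <;> try omega
  all_goals obtain c2 | c2 | c2 | c2 | c2 := even_cases (h4 2) (hev 2) <;> try omega
  all_goals obtain c3 | c3 | c3 | c3 | c3 := even_cases (h4 3) (hev 3) <;> omega

theorem ofFn_relDeg_eq_of_card_filter_five {r : Fin 5 → ℕ} (hr : Monotone r) (h4 : ∀ i, 4 ≤ r i)
    (hev : ∀ i, Even (r i)) (hp : (Finset.univ.filter fun i => r i = 4).card = 2)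
    (hq : (Finset.univ.filter fun i => r i = 6).card = 1)
    (hs : (Finset.univ.filter fun i => 4 ∣ r i ∧ 8 ≤ r i).card = 2)
    (ht : (Finset.univ.filter fun i => 4 ∣ r i ∧ 12 ≤ r i).card = 1) (hsum : ∑ i, r i ≤ 34) :
    List.ofFn r = [4, 4, 6, 8, 12] := by
  have h01 : r 0 ≤ r 1 := hr (by decide)
  have h12 : r 1 ≤ r 2 := hr (by decide)
  have h23 : r 2 ≤ r 3 := hr (by decide)
  have h34 : r 3 ≤ r 4 := hr (by decide)
  rw [Finset.card_filter, Fin.sum_univ_five] at hp hq hs ht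
  rw [Fin.sum_univ_five] at hsum
  suffices h : r 0 = 4 ∧ r 1 = 4 ∧ r 2 = 6 ∧ r 3 = 8 ∧ r 4 = 12 by
    simp [List.ofFn_succ, h.1, h.2.1, h.2.2.1, h.2.2.2.1, ← h.2.2.2.2]
  obtain c0 | c0 | c0 | c0 | c0 := even_cases (h4 0) (hev 0) <;> try omega
  all_goals obtain c1 | c1 | c1 | c1 | c1 := even_cases (h4 1) (hev 1) <;> try omega
  all_goals obtain c2 | c2 | c2 | c2 | c2 := even_cases (h4 2) (hev 2) <;> try omega
  all_goals obtain c3 | c3 | c3 | c3 | c3 := even_cases (h4 3) (hev 3) <;> try omega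
  all_goals obtain c4 | c4 | c4 | c4 | c4 := even_cases (h4 4) (hev 4) <;> omega

theorem ofFn_eq_of_card_filter {k : ℕ} {d r : Fin k → ℕ} (hd : Monotone d) (hr : Monotone r)
    (hdeg : ∀ i, d i = 2 ∨ d i = 4) (h4 : ∀ i, 4 ≤ r i) (hev : ∀ i, Even (r i))
    (hk : k = 4 ∨ k = 5) (ha : (Finset.univ.filter fun i => d i = 2).card + 2 = k)
    (hp : (Finset.univ.filter fun i => r i = 4).card + 3 = k)
    (hq : (Finset.univ.filter fun i => r i = 6).card = 1)
    (hs : (Finset.univ.filter fun i => 4 ∣ r i ∧ 8 ≤ r i).card = 2)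
    (ht : (Finset.univ.filter fun i => 4 ∣ r i ∧ 12 ≤ r i).card = 1)
    (hsum : ∑ i, r i ≤ 24 + 2 * k) :
    (List.ofFn d = [2, 2, 4, 4] ∧ List.ofFn r = [4, 6, 8, 12]) ∨
      (List.ofFn d = [2, 2, 2, 4, 4] ∧ List.ofFn r = [4, 4, 6, 8, 12]) := by
  obtain rfl | rfl := hk
  · exact Or.inl ⟨ofFn_eq_of_card_filter_four hd hdeg (by omega),
      ofFn_relDeg_eq_of_card_filter_four hr h4 hev (by omega) hq hs ht (by omega)⟩
  · exact Or.inr ⟨ofFn_eq_of_card_filter_five hd hdeg (by omega),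
      ofFn_relDeg_eq_of_card_filter_five hr h4 hev (by omega) hq hs ht (by omega)⟩

/-! ### Solving the inequalities -/

namespace PositivelyElliptic

variable {P : PositivelyElliptic}

theorem card_deg_two_add_card_deg_four (hdeg : ∀ i, P.deg i = 2 ∨ P.deg i = 4) :
    (Finset.univ.filter fun i => P.deg i = 2).card +
      (Finset.univ.filter fun i => P.deg i = 4).card = P.k := by
  rw [← Finset.card_union_of_disjoint (Finset.disjoint_filter.mpr fun i _ h => by omega),
    ← Finset.filter_or, Finset.filter_true_of_mem fun i _ => hdeg i, Finset.card_univ,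
    Fintype.card_fin]

theorem sum_deg_eq (hdeg : ∀ i, P.deg i = 2 ∨ P.deg i = 4) :
    ∑ i, P.deg i = 2 * P.k + 2 * (Finset.univ.filter fun i => P.deg i = 4).card := by
  rw [Finset.card_filter, Finset.mul_sum]
  have : 2 * P.k = ∑ _i : Fin P.k, 2 := by simp [mul_comm]
  rw [this, ← Finset.sum_add_distrib]
  exact Finset.sum_congr rfl fun i _ => by obtain h | h := hdeg i <;> simp [h]

/-- Compare each degree with 6: a relation of degree 4 falls short by 2, a multiple of 4 from 8 on
exceeds 6 by at least 2, and from 12 on by at least 6 = 2 + 4. -/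
theorem six_mul_le_sum_relDeg (hP : P.IsPureModel) :
    6 * P.k + 2 * (Finset.univ.filter fun i => 4 ∣ P.relDeg i ∧ 8 ≤ P.relDeg i).card +
      4 * (Finset.univ.filter fun i => 4 ∣ P.relDeg i ∧ 12 ≤ P.relDeg i).card ≤
    ∑ i, P.relDeg i + 2 * (Finset.univ.filter fun i => P.relDeg i = 4).card := by
  simp only [Finset.card_filter, Finset.mul_sum]
  have : 6 * P.k = ∑ _i : Fin P.k, 6 := by simp [mul_comm]
  rw [this, ← Finset.sum_add_distrib, ← Finset.sum_add_distrib, ← Finset.sum_add_distrib]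
  refine Finset.sum_le_sum fun i _ => ?_
  obtain c | c | c | c | c := even_cases (four_le_relDeg hP i) (even_relDeg i) <;> omega

theorem card_relDeg_add_le :
    (Finset.univ.filter fun i => P.relDeg i = 4).card +
      (Finset.univ.filter fun i => P.relDeg i = 6).card +
      (Finset.univ.filter fun i => 4 ∣ P.relDeg i ∧ 8 ≤ P.relDeg i).card ≤ P.k := by
  simp only [Finset.card_filter]
  have : P.k = ∑ _i : Fin P.k, 1 := by simp
  refine le_of_le_of_eq ?_ this.symm
  rw [← Finset.sum_add_distrib, ← Finset.sum_add_distrib]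
  refine Finset.sum_le_sum fun i _ => ?_
  split_ifs <;> omega

/-- The possible degree types for generators of degrees `2` and `4` and formal dimension at most
`20`. The non-splitting of `H` is not needed: it would only exclude further types. -/
theorem degreeType_of_deg_cases (hP : P.IsPureModel) (hder : P.HasNegativeDerivation)
    (hdeg : ∀ i, P.deg i = 2 ∨ P.deg i = 4) (hfd : P.formalDimension ≤ 20) :
    P.degreeType = ([2, 2, 4, 4], [4, 6, 8, 12]) ∨
      P.degreeType = ([2, 2, 2, 4, 4], [4, 4, 6, 8, 12]) := by
  obtain ⟨L, j, hj⟩ := hder.exists_loweringDerivation hP hdeg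
  obtain ⟨N, hN, hNfd, -⟩ := exists_top hP
  have hr2 := L.two_le_rank hP hj
  have hra := L.rank_le_card_deg_two
  have hrb := L.rank_le_card_deg_four
  have hbs := LoweringDerivation.card_deg_four_le hP hdeg
  have hrt := L.rank_le hP
  have hdp := L.finrank_sqImage_le_four hP
  have hdq := L.finrank_sqImage_le_six hP
  have hpq := L.card_add_card_le_rank hP
  have hS := L.false_of_card_eq_two hP
  have hk := card_deg_two_add_card_deg_four hdeg
  have hsum := sum_deg_eq hdeg
  have hsum' := six_mul_le_sum_relDeg hP
  have hcard := card_relDeg_add_le (P := P)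
  have hpq' : ¬ ((Finset.univ.filter fun i => P.relDeg i = 4).card = Module.finrank ℚ L.sqImage ∧
      (Finset.univ.filter fun i => P.relDeg i = 6).card = Module.finrank ℚ L.sqImage ∧
      L.rank < (Finset.univ.filter fun i => P.relDeg i = 4).card +
        (Finset.univ.filter fun i => P.relDeg i = 6).card) :=
    fun h => (hpq h.1 h.2.1).not_gt h.2.2
  have hS' : ¬ ((Finset.univ.filter fun i => P.deg i = 2).card = 2 ∧
      (Finset.univ.filter fun i => P.relDeg i = 4).card = 2) := fun h => hS h.1 h.2 hr2
  -- The degree sums give 2k + s + 2t ≤ 10 + b + p; with p + q + s ≤ k and k = a + b this becomes a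
  -- + q + 2s + 2t ≤ 10. Since s ≥ b ≥ r ≥ 2, a ≥ r and t + q ≥ t + d ≥ r, few cases remain. `hpq'`
  -- excludes t = 0, and `hS'` excludes t = 2.
  have hs : (Finset.univ.filter fun i => 4 ∣ P.relDeg i ∧ 8 ≤ P.relDeg i).card = 2 := by omega
  have hb : (Finset.univ.filter fun i => P.deg i = 4).card = 2 := by omega
  have ht : (Finset.univ.filter fun i => 4 ∣ P.relDeg i ∧ 12 ≤ P.relDeg i).card = 1 := by omega
  have hq : (Finset.univ.filter fun i => P.relDeg i = 6).card = 1 := by omega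
  have hk' : P.k = 4 ∨ P.k = 5 := by omega
  have ha : (Finset.univ.filter fun i => P.deg i = 2).card + 2 = P.k := by omega
  have hp : (Finset.univ.filter fun i => P.relDeg i = 4).card + 3 = P.k := by omega
  have hsum'' : ∑ i, P.relDeg i ≤ 24 + 2 * P.k := by omega
  simpa [degreeType] using ofFn_eq_of_card_filter hP.deg_mono hP.relDeg_mono hdeg
    (four_le_relDeg hP) even_relDeg hk' ha hp hq hs ht hsum''

end PositivelyElliptic

theorem proposition3p2 (H : PositivelyElliptic) (hpure : H.IsPureModel)
    (hsplit : ¬ H.Splits) (hder : H.HasNegativeDerivation) (hk : 2 ≤ H.k)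
    (h8 : H.deg ⟨H.k - 2, by omega⟩ + H.deg ⟨H.k - 1, by omega⟩ ≤ 8) :
    20 < H.formalDimension ∨
      H.degreeType = ([2, 2, 4, 4], [4, 6, 8, 12]) ∨
      H.degreeType = ([2, 2, 4, 4], [4, 8, 8, 12]) ∨
      H.degreeType = ([2, 2, 2, 4, 4], [4, 4, 6, 8, 12]) := by
  obtain hfd | hfd := lt_or_ge 20 H.formalDimension
  · exact Or.inl hfd
  refine Or.inr ?_
  have hpos := H.deg_pos
  have htwo : ∀ i, ∃ c, H.deg i = 2 * c := fun i => (H.deg_even i).imp fun c hc => by omega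
  have hlast : ∀ i : Fin H.k, H.deg i ≤ H.deg ⟨H.k - 1, by omega⟩ := fun i =>
    hpure.deg_mono (Fin.mk_le_mk.mpr (Nat.le_sub_one_of_lt i.2))
  have hpre : ∀ i : Fin H.k, i ≠ ⟨H.k - 1, by omega⟩ → H.deg i ≤ H.deg ⟨H.k - 2, by omega⟩ :=
    fun i hi => hpure.deg_mono (Fin.le_def.mpr (by
      have := i.2
      have : i.1 ≠ H.k - 1 := fun h => hi (Fin.ext h)
      change i.1 ≤ H.k - 2
      omega))
  generalize hl : (⟨H.k - 1, by omega⟩ : Fin H.k) = l at *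
  generalize hm : (⟨H.k - 2, by omega⟩ : Fin H.k) = m at *
  obtain ⟨a, ha⟩ := htwo l
  obtain ⟨b, hb⟩ := htwo m
  have hml := hlast m
  have hposm := hpos m
  -- If the second largest degree is 2, a derivation lowering degrees by at least 2 can move only
  -- the last variable. Otherwise the bound 8 makes the two largest degrees equal to 4.
  by_cases hm2 : H.deg m = 2
  · exfalso
    obtain ⟨D, e, he, hD, hD0, hDI, j, hj⟩ := hder.exists_lift hpure
    exact PositivelyElliptic.false_of_derivation_X_eq_zero hpure (by omega) hD hD0 hDI (i := l)
      (fun i hi => hD0 i (by have := hpre i hi; omega)) hj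
  · have hdeg : ∀ i, H.deg i = 2 ∨ H.deg i = 4 := fun i => by
      have h1 := hlast i
      have h2 := hpos i
      obtain ⟨c, hc⟩ := htwo i
      omega
    obtain h | h := PositivelyElliptic.degreeType_of_deg_cases hpure hder hdeg hfd
    · exact Or.inl h
    · exact Or.inr (Or.inr h)
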